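/- A conformal pseudo-metric $\lambda(z)\,|dz|$ on a domain $G\subseteq\mathbb C$ is given by a continuous density $\lambda:G\to[0,\infty)$, $\lambda\not\equiv 0$; it is a conformal metric if $\lambda>0$ on $G$, and it is regular if $\lambda$ is of class $C^2$ on $\{\lambda>0\}$. At points with $\lambda(z)>0$ its generalized curvature is $$\kappa_\lambda(z)=-\frac{\Delta(\log\lambda)(z)}{\lambda(z)^2}\in[-\infty,\infty],\qquad \Delta u(z):=\liminf_{r\to0^+}\frac4{r^2}\Big(\frac1{2\pi}\int_0^{2\pi}u(z+re^{it})\,dt-u(z)\Big),$$ and for regular pseudo-metrics the curvature is given by the same formula with the classical Laplacian. A conformal pseudo-metric on $G$ is called an SK-metric if $\kappa_\lambda(z)\le-1$ at every $z\in G$ with $\lambda(z)>0$. **Theorem.** Let $G\subseteq\mathbb C$ be a domain, and let $\Phi_G$ be the family of all densities of SK-metrics on $G$. If $\Phi_G\neq\emptyset$, then $$\lambda_G(z):=\sup_{\lambda\in\Phi_G}\lambda(z)$$ is finite for every $z\in G$ and induces a regular conformal metric $\lambda_G(z)\,|dz|$ of constant (classical) curvature $-1$ on $G$. In particular, $\lambda_G(z)\,|dz|$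 is an SK-metric on $G$, every SK-metric $\lambda(z)\,|dz|$ on $G$ satisfies $\lambda\le\lambda_G$ on $G$, and $\lambda_G(z)\,|dz|$ is the unique maximal SK-metric on $G$ (i.e. the only SK-metric on $G$ that is not dominated pointwise by a different SK-metric on $G$). -/

import Mathlib

open Filter Topology Set

noncomputable section

namespace SKMetric

/-- A domain in the complex plane: a nonempty connected open set. -/
def IsDomain (G : Set ℂ) : Prop := IsOpen G ∧ IsConnected G

/-- A conformal density on `G` (equivalently, a conformal pseudo-metric `ρ(z) |dz|`): a continuous
function `ρ : G → [0, ∞)` which is not identically zero.  Functions on `G` are represented by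
functions on `ℂ`, of which only the values on `G` matter. -/
structure IsConformalPseudoMetric (G : Set ℂ) (ρ : ℂ → ℝ) : Prop where
  continuousOn : ContinuousOn ρ G
  nonneg : ∀ z ∈ G, 0 ≤ ρ z
  not_identically_zero : ∃ z ∈ G, ρ z ≠ 0

/-- A conformal metric is a conformal pseudo-metric with positive density. -/
structure IsConformalMetric (G : Set ℂ) (ρ : ℂ → ℝ) : Prop
    extends IsConformalPseudoMetric G ρ where
  pos : ∀ z ∈ G, 0 < ρ z

/-- A conformal pseudo-metric is regular if its density is of class `C²` (in the real sense)
where it is positive. -/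
def IsRegular (G : Set ℂ) (ρ : ℂ → ℝ) : Prop :=
  ContDiffOn ℝ 2 ρ {z ∈ G | 0 < ρ z}

/-- The classical Gauss curvature `-Δ(log ρ)(z) / ρ(z)²` of a regular conformal
pseudo-metric, at points where `ρ` is positive. -/
def gaussCurvature (ρ : ℂ → ℝ) (z : ℂ) : ℝ :=
  -(Laplacian.laplacian (fun w : ℂ => Real.log (ρ w)) z) / ρ z ^ 2

/-- The generalized lower Laplace operator
`liminf_{r → 0+} (4 / r²) ((1 / 2π) ∫_0^{2π} u(z + r e^{it}) dt - u(z))`,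
an extended real number. -/
def lowerLaplacian (u : ℂ → ℝ) (z : ℂ) : EReal :=
  liminf (fun r : ℝ => ((4 / r ^ 2 * (Real.circleAverage u z r - u z) : ℝ) : EReal)) (𝓝[>] 0)

/-- The generalized Gauss curvature of a conformal pseudo-metric, at points where `ρ` is positive;
an extended real number. -/
def lowerCurvature (ρ : ℂ → ℝ) (z : ℂ) : EReal :=
  -(lowerLaplacian (fun w => Real.log (ρ w)) z) / ((ρ z ^ 2 : ℝ) : EReal)

/-- An SK-metric on `G`: a conformal pseudo-metric whose generalized curvature is at most `-1`
at every point of `G` where its density is positive. -/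
structure IsSKMetric (G : Set ℂ) (ρ : ℂ → ℝ) : Prop
    extends IsConformalPseudoMetric G ρ where
  curvature_le : ∀ z ∈ G, 0 < ρ z → lowerCurvature ρ z ≤ -1

/-- The family of (densities of) all SK-metrics on `G`. -/
def skMetrics (G : Set ℂ) : Set (ℂ → ℝ) := {ρ | IsSKMetric G ρ}

/-- The pointwise supremum of all SK-metrics on `G`. -/
def hyperbolicDensity (G : Set ℂ) (z : ℂ) : ℝ :=
  sSup {x : ℝ | ∃ ρ ∈ skMetrics G, ρ z = x}

/-- A maximal SK-metric on `G`: no other SK-metric on `G` dominates it pointwise on `G`. -/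
def IsMaximalSKMetric (G : Set ℂ) (μ : ℂ → ℝ) : Prop :=
  IsSKMetric G μ ∧ ∀ ν, IsSKMetric G ν → (∀ z ∈ G, μ z ≤ ν z) → EqOn μ ν G

end SKMetric

end

/-!
# The maximal SK-metric on a plane domain

Write `Λ` for the pointwise supremum of all SK-metrics on `G` (`hyperbolicDensity G`). In terms of
`u = log ρ`, an SK-metric is a subsolution of Liouville's equation `Δu = exp (2u)`, and a density
of constant curvature `-1` is a solution. The theorem says that the largest subsolution is a
solution.

Everything is expressed through the generalized Laplacian defined by circle averages
(`HasMeanLaplacianAt` when the limit exists). It agrees with the classical Laplacian of a twice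
differentiable function (`hasMeanLaplacianAt_of_contDiffAt`), and at a local maximum of `u - v`
the lower Laplacian of `u` is at most the Laplacian of `v` (`lowerLaplacian_le_of_isLocalMax`).
This maximum principle gives all comparison results.

* *Finiteness.* By Ahlfors' lemma (`IsSKMetric.mul_le_one`), SK-metrics are bounded by the
  hyperbolic metrics of discs in `G`, uniformly on compact sets.
* *Positivity.* If the complement of `G` had at most one point, comparison with the hyperbolic
  metrics of large annuli would force every SK-metric to vanish. So `G` omits two points, and then
  it carries an explicit positive SK-metric `σ` (`exists_pos_isSKMetric`). Replacing `ρ` by `max ρ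
  σ`, only positive SK-metrics need to be considered, and their logarithms are continuous.
* *The Dirichlet problem.* On a small disc, `ΔV = exp (2V)` with prescribed continuous boundary
  values is solved by the contraction principle, inverting the Laplacian by the logarithmic
  potential corrected by a Poisson integral (`exists_liouvilleSolution`). The fixed point is `C¹`
  because potentials of bounded functions are; it is `C²` because potentials of compactly
  supported `C¹` functions are, and a continuous function with vanishing generalized Laplacian is
  harmonic (`contDiffAt_two_of_hasMeanLaplacianAt`). The representation also bounds `|V z - V c|`
  by `L ‖z - c‖` at the centre `c`, with `L` depending only on bounds for the boundary values.
* *Continuity of `Λ`.* Replacing a positive SK-metric on a small disc by the solution with the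
  same boundary values gives a larger SK-metric (`IsSKMetric.glue`), so `Λ` is a supremum of
  functions that are equicontinuous at the centre of the disc (`continuousAt_hyperbolicDensity`).
* *Conclusion.* On a small disc let `V` be the solution with boundary values `log Λ`. Comparison
  gives `Λ ≤ exp V`. Conversely, SK-metrics are stable under `max`, so by compactness some
  SK-metric exceeds `exp (-ε) Λ` on the boundary circle; gluing the corresponding solution into it
  and comparing gives `exp V ≤ exp ε Λ`. Hence `Λ = exp V`
  (`exists_liouville_eq_hyperbolicDensity`), which is `C²` with curvature `-1`, and the remaining
  assertions follow formally.
-/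

namespace SKMetric

/-! ### The generalized Laplacian and the maximum principle -/

open Real in
/-- The generalized Laplacian of `u` at `z` exists as a genuine limit and is the real number `L`. -/
def HasMeanLaplacianAt (u : ℂ → ℝ) (L : ℝ) (z : ℂ) : Prop :=
  Tendsto (fun r : ℝ => 4 / r ^ 2 * (circleAverage u z r - u z)) (𝓝[>] 0) (𝓝 L)

lemma eventually_sphere {p : ℂ → Prop} {z : ℂ} (h : ∀ᶠ w in 𝓝 z, p w) :
    ∀ᶠ r : ℝ in 𝓝[>] 0, 0 < r ∧ ∀ w ∈ Metric.sphere z |r|, p w := by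
  obtain ⟨ε, hε, H⟩ := Metric.eventually_nhds_iff.1 h
  filter_upwards [Ioo_mem_nhdsGT hε] with r hr
  refine ⟨hr.1, fun w hw => H ?_⟩
  rw [Metric.mem_sphere, abs_of_pos hr.1] at hw
  rw [hw]; exact hr.2

lemma eventually_circleIntegrable {u : ℂ → ℝ} {z : ℂ} (h : ∀ᶠ w in 𝓝 z, ContinuousAt u w) :
    ∀ᶠ r : ℝ in 𝓝[>] 0, CircleIntegrable u z r := by
  filter_upwards [eventually_sphere h] with r hr
  exact ContinuousOn.circleIntegrable' fun w hw => (hr.2 w hw).continuousWithinAt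

namespace HasMeanLaplacianAt

variable {u v : ℂ → ℝ} {L K : ℝ} {z : ℂ}

lemma lowerLaplacian_eq (h : HasMeanLaplacianAt u L z) : lowerLaplacian u z = (L : EReal) :=
  Tendsto.liminf_eq ((continuous_coe_real_ereal.tendsto L).comp h)

lemma unique (h : HasMeanLaplacianAt u L z) (h' : HasMeanLaplacianAt u K z) : L = K :=
  tendsto_nhds_unique h h'

lemma congr (h : HasMeanLaplacianAt u L z) (huv : ∀ᶠ w in 𝓝 z, u w = v w) :
    HasMeanLaplacianAt v L z := by
  refine Tendsto.congr' ?_ h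
  filter_upwards [eventually_sphere huv] with r hr
  rw [Real.circleAverage_congr_sphere (fun w hw => hr.2 w hw), huv.self_of_nhds]

lemma add (h : HasMeanLaplacianAt u L z) (h' : HasMeanLaplacianAt v K z)
    (hu : ∀ᶠ w in 𝓝 z, ContinuousAt u w) (hv : ∀ᶠ w in 𝓝 z, ContinuousAt v w) :
    HasMeanLaplacianAt (fun w => u w + v w) (L + K) z := by
  refine Tendsto.congr' ?_ (Tendsto.add h h')
  filter_upwards [eventually_circleIntegrable hu, eventually_circleIntegrable hv] with r h1 h2
  rw [Real.circleAverage_fun_add h1 h2]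
  ring

lemma const_mul (c : ℝ) (h : HasMeanLaplacianAt u L z) :
    HasMeanLaplacianAt (fun w => c * u w) (c * L) z := by
  refine Tendsto.congr (fun r => ?_) (Tendsto.const_mul c h)
  have := Real.circleAverage_fun_smul (a := c) (f := u) (c := z) (R := r)
  simp only [smul_eq_mul] at this
  rw [this]
  ring

lemma add_const (c : ℝ) (h : HasMeanLaplacianAt u L z) (hu : ∀ᶠ w in 𝓝 z, ContinuousAt u w) :
    HasMeanLaplacianAt (fun w => u w + c) L z := by
  refine Tendsto.congr' ?_ h
  filter_upwards [eventually_circleIntegrable hu] with r h1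
  rw [Real.circleAverage_fun_add h1 (circleIntegrable_const c z r), Real.circleAverage_const]
  ring

end HasMeanLaplacianAt

lemma lowerLaplacian_mono {u v : ℂ → ℝ} {z : ℂ} (huv : ∀ᶠ w in 𝓝 z, u w ≤ v w) (hz : u z = v z)
    (hu : ∀ᶠ w in 𝓝 z, ContinuousAt u w) (hv : ∀ᶠ w in 𝓝 z, ContinuousAt v w) :
    lowerLaplacian u z ≤ lowerLaplacian v z := by
  refine liminf_le_liminf ?_
  filter_upwards [eventually_circleIntegrable hu, eventually_circleIntegrable hv,
    eventually_sphere huv] with r h1 h2 h3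
  rw [EReal.coe_le_coe_iff, hz]
  have := Real.circleAverage_mono h1 h2 h3.2
  gcongr

/-- The maximum principle behind all comparison arguments: near `z`, `u` lies below a translate of
`v` which touches it at `z`. -/
lemma lowerLaplacian_le_of_isLocalMax {u v : ℂ → ℝ} {z : ℂ} {L : ℝ}
    (hmax : ∀ᶠ w in 𝓝 z, u w - v w ≤ u z - v z) (hL : HasMeanLaplacianAt v L z)
    (hu : ∀ᶠ w in 𝓝 z, ContinuousAt u w) (hv : ∀ᶠ w in 𝓝 z, ContinuousAt v w) :
    lowerLaplacian u z ≤ (L : EReal) := by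
  rw [← (hL.add_const (u z - v z) hv).lowerLaplacian_eq]
  refine lowerLaplacian_mono ?_ (by ring) hu ?_
  · filter_upwards [hmax] with w hw
    linarith
  · filter_upwards [hv] with w hw
    exact hw.add continuousAt_const

/-- Second order Taylor expansion at a point where the first derivative is differentiable. -/
lemma taylor_two_isLittleO {u : ℂ → ℝ} {u' : ℂ → ℂ →L[ℝ] ℝ} {u'' : ℂ →L[ℝ] ℂ →L[ℝ] ℝ} {z : ℂ}
    (hu : ∀ᶠ w in 𝓝 z, HasFDerivAt u (u' w) w) (hu' : HasFDerivAt u' u'' z) {ε : ℝ} (hε : 0 < ε) :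
    ∀ᶠ w in 𝓝 z, |u w - u z - u' z (w - z) - u'' (w - z) (w - z) / 2| ≤ ε * ‖w - z‖ ^ 2 := by
  have hsymm := second_derivative_symmetric_of_eventually hu hu'
  have h1 : ∀ᶠ w in 𝓝 z, ‖u' w - u' z - u'' (w - z)‖ ≤ ε * ‖w - z‖ :=
    (Asymptotics.isLittleO_iff.1 hu'.isLittleO) hε
  obtain ⟨δ, hδ, H⟩ := Metric.eventually_nhds_iff_ball.1 (hu.and h1)
  filter_upwards [Metric.ball_mem_nhds z hδ] with w hw
  -- the mean value inequality, applied to the remainder, whose derivative is `o(‖x - z‖)`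
  have hd : ∀ x ∈ Metric.closedBall z ‖w - z‖, HasFDerivWithinAt
      (fun x => u x - u' z (x - z) - u'' (x - z) (x - z) / 2)
      (u' x - u' z - u'' (x - z)) (Metric.closedBall z ‖w - z‖) x := by
    intro x hx
    have hx' : x ∈ Metric.ball z δ := by
      rw [Metric.mem_closedBall] at hx
      rw [Metric.mem_ball] at hw ⊢
      rw [dist_eq_norm] at hw
      exact hx.trans_lt hw
    have e1 := (H x hx').1
    have e0 : HasFDerivAt (fun x : ℂ => x - z) (ContinuousLinearMap.id ℝ ℂ) x :=
      (hasFDerivAt_id x).sub_const z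
    have e2 : HasFDerivAt (fun x => u' z (x - z)) (u' z) x := by
      simpa only [ContinuousLinearMap.comp_id, Function.comp_def] using
        ((u' z).hasFDerivAt (x := x - z)).comp x e0
    have e4 : HasFDerivAt (fun x => u'' (x - z)) u'' x := by
      simpa only [ContinuousLinearMap.comp_id, Function.comp_def] using
        (u''.hasFDerivAt (x := x - z)).comp x e0
    have e3 := e4.clm_apply e0
    refine (((e1.sub e2).sub (e3.mul_const (1 / 2 : ℝ))).congr_fderiv ?_).hasFDerivWithinAt.congr
      (fun y _ => by simp; ring) (by simp; ring)
    refine ContinuousLinearMap.ext fun y => ?_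
    have h5 := hsymm y x
    have h6 := hsymm y z
    simp
    linarith
  have := Convex.norm_image_sub_le_of_norm_hasFDerivWithin_le (C := ε * ‖w - z‖) hd ?_
    (convex_closedBall _ _) (Metric.mem_closedBall_self (norm_nonneg _))
    (show w ∈ Metric.closedBall z ‖w - z‖ by simp [dist_eq_norm])
  · simp only [sub_self, map_zero, zero_div, sub_zero, Real.norm_eq_abs] at this
    refine le_trans (le_of_eq ?_) (this.trans (le_of_eq (by ring)))
    congr 1
    ring
  · intro x hx
    rw [Metric.mem_closedBall] at hx
    refine (H x ?_).2.trans ?_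
    · rw [Metric.mem_ball] at hw ⊢
      rw [dist_eq_norm] at hw
      exact hx.trans_lt hw
    · rw [dist_eq_norm] at hx
      gcongr

lemma circleAverage_clm (A : ℂ →L[ℝ] ℝ) (z : ℂ) (r : ℝ) :
    Real.circleAverage (fun w => A (w - z)) z r = 0 := by
  have : Real.circleAverage (fun w => A (w - z)) z r = A (z - z) := by
    have h := A.circleAverage_comp_comm (f := fun w : ℂ => w - z) (c := z) (R := r)
      (ContinuousOn.circleIntegrable' (by fun_prop))
    have h2 : Real.circleAverage (fun w : ℂ => w - z) z r = 0 := by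
      have h3 := integral_exp_mul_complex (a := 0) (b := 2 * Real.pi) Complex.I_ne_zero
      simp only [mul_comm Complex.I] at h3
      simp [Real.circleAverage, circleMap, h3]
    rw [h2] at h
    simpa [Function.comp_def] using h
  simpa using this

lemma circleAverage_bilin (Q : ℂ →L[ℝ] ℂ →L[ℝ] ℝ) (z : ℂ) (r : ℝ) :
    Real.circleAverage (fun w => Q (w - z) (w - z)) z r
      = r ^ 2 / 2 * (Q 1 1 + Q Complex.I Complex.I) := by
  have e : ∀ θ : ℝ, Q (circleMap z r θ - z) (circleMap z r θ - z)
      = r ^ 2 * Q 1 1 * Real.cos θ ^ 2 + r ^ 2 * Q Complex.I Complex.I * Real.sin θ ^ 2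
        + r ^ 2 * (Q 1 Complex.I + Q Complex.I 1) * (Real.sin θ * Real.cos θ) := by
    intro θ
    have : circleMap z r θ - z = (r * Real.cos θ) • (1 : ℂ) + (r * Real.sin θ) • Complex.I := by
      simp [circleMap, Complex.exp_mul_I]
      ring
    rw [this]
    simp only [map_add, map_smul, add_apply, smul_apply,
      smul_eq_mul]
    ring
  simp only [Real.circleAverage, e]
  rw [intervalIntegral.integral_add (by apply Continuous.intervalIntegrable; fun_prop)
    (by apply Continuous.intervalIntegrable; fun_prop),
    intervalIntegral.integral_add (by apply Continuous.intervalIntegrable; fun_prop)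
    (by apply Continuous.intervalIntegrable; fun_prop)]
  simp only [intervalIntegral.integral_const_mul, integral_cos_sq, integral_sin_sq,
    integral_sin_mul_cos₁]
  simp
  field_simp

/-- Where `u` is twice differentiable, its generalized Laplacian is the trace of the second
derivative. -/
theorem hasMeanLaplacianAt_of_hasFDerivAt {u : ℂ → ℝ} {u' : ℂ → ℂ →L[ℝ] ℝ}
    {u'' : ℂ →L[ℝ] ℂ →L[ℝ] ℝ} {z : ℂ}
    (hu : ∀ᶠ w in 𝓝 z, HasFDerivAt u (u' w) w) (hu' : HasFDerivAt u' u'' z) :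
    HasMeanLaplacianAt u (u'' 1 1 + u'' Complex.I Complex.I) z := by
  rw [HasMeanLaplacianAt, Metric.tendsto_nhds]
  intro ε hε
  filter_upwards [eventually_sphere (taylor_two_isLittleO hu hu' (show 0 < ε / 8 by positivity)),
    eventually_circleIntegrable (hu.mono fun w hw => hw.continuousAt)] with r hr hi
  have hi1 : CircleIntegrable (fun w => u' z (w - z)) z r :=
    ContinuousOn.circleIntegrable' (by fun_prop)
  have hi2 : CircleIntegrable (fun w => (1 / 2 : ℝ) • u'' (w - z) (w - z)) z r :=
    ContinuousOn.circleIntegrable' (by fun_prop)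
  have hic : CircleIntegrable (fun _ => u z) z r := circleIntegrable_const _ _ _
  have hA : Real.circleAverage
      (fun w => ((u w - u z) - u' z (w - z)) - (1 / 2 : ℝ) • u'' (w - z) (w - z)) z r
      = Real.circleAverage u z r - u z
        - r ^ 2 / 4 * (u'' 1 1 + u'' Complex.I Complex.I) := by
    rw [Real.circleAverage_fun_sub (f₁ := fun w => u w - u z - u' z (w - z)) ((hi.sub hic).sub hi1) hi2,
      Real.circleAverage_fun_sub (f₁ := fun w => u w - u z) (hi.sub hic) hi1, Real.circleAverage_fun_sub hi hic,
      Real.circleAverage_const, circleAverage_clm, Real.circleAverage_fun_smul,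
      circleAverage_bilin]
    simp only [smul_eq_mul]
    ring
  have hB : |Real.circleAverage
      (fun w => ((u w - u z) - u' z (w - z)) - (1 / 2 : ℝ) • u'' (w - z) (w - z)) z r|
      ≤ ε / 8 * r ^ 2 := by
    refine Real.abs_circleAverage_le_circleAverage_abs.trans ?_
    refine Real.circleAverage_mono_on_of_le_circle
      (((hi.sub hic).sub hi1).sub hi2).abs fun w hw => ?_
    have := hr.2 w hw
    rw [Metric.mem_sphere, dist_eq_norm, abs_of_pos hr.1] at hw
    rw [hw] at this
    refine le_trans (le_of_eq ?_) this
    simp only [Pi.abs_apply, smul_eq_mul]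
    congr 1
    ring
  rw [hA] at hB
  have hr0 := hr.1
  rw [Real.dist_eq]
  have e : 4 / r ^ 2 * (Real.circleAverage u z r - u z) - (u'' 1 1 + u'' Complex.I Complex.I)
      = 4 / r ^ 2 * (Real.circleAverage u z r - u z
        - r ^ 2 / 4 * (u'' 1 1 + u'' Complex.I Complex.I)) := by
    field_simp
  rw [e, abs_mul, abs_of_pos (show 0 < 4 / r ^ 2 by positivity)]
  calc 4 / r ^ 2 * _ ≤ 4 / r ^ 2 * (ε / 8 * r ^ 2) := by gcongr
    _ = ε / 2 := by field_simp; norm_num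
    _ < ε := by linarith

theorem hasMeanLaplacianAt_of_contDiffAt {u : ℂ → ℝ} {z : ℂ} (hu : ContDiffAt ℝ 2 u z) :
    HasMeanLaplacianAt u (Laplacian.laplacian u z) z := by
  have h1 : ∀ᶠ w in 𝓝 z, HasFDerivAt u (fderiv ℝ u w) w := by
    filter_upwards [hu.eventually (by simp)] with w hw
    exact (hw.differentiableAt (by norm_num)).hasFDerivAt
  have h2 : HasFDerivAt (fderiv ℝ u) (fderiv ℝ (fderiv ℝ u) z) z :=
    ((hu.fderiv_right (m := 1) (by norm_num)).differentiableAt (by norm_num)).hasFDerivAt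
  have := hasMeanLaplacianAt_of_hasFDerivAt h1 h2
  rw [InnerProductSpace.laplacian_eq_iteratedFDeriv_complexPlane]
  simpa [iteratedFDeriv_two_apply] using this

/-- The Laplacian of a function of `s = ‖z - a‖ ^ 2` is `4 φ'(s) + 4 s φ''(s)`. -/
theorem hasMeanLaplacianAt_radial {φ φ' : ℝ → ℝ} {φ'' : ℝ} {a z : ℂ}
    (hφ : ∀ᶠ t in 𝓝 (‖z - a‖ ^ 2), HasDerivAt φ (φ' t) t)
    (hφ' : HasDerivAt φ' φ'' (‖z - a‖ ^ 2)) :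
    HasMeanLaplacianAt (fun w => φ (‖w - a‖ ^ 2))
      (4 * φ' (‖z - a‖ ^ 2) + 4 * ‖z - a‖ ^ 2 * φ'') z := by
  have hsq : ∀ w : ℂ, HasFDerivAt (fun w : ℂ => ‖w - a‖ ^ 2) (2 • innerSL ℝ (w - a)) w := by
    intro w
    simpa using ((hasFDerivAt_id w).sub_const a).norm_sq
  have hc : ContinuousAt (fun w : ℂ => ‖w - a‖ ^ 2) z := (hsq z).continuousAt
  have h1 : ∀ᶠ w in 𝓝 z, HasFDerivAt (fun w => φ (‖w - a‖ ^ 2))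
      (φ' (‖w - a‖ ^ 2) • (2 • innerSL ℝ (w - a))) w := by
    filter_upwards [hc.eventually hφ] with w hw
    exact hw.comp_hasFDerivAt w (hsq w)
  have h2 : HasFDerivAt (fun w : ℂ => (2 • innerSL ℝ (w - a) : ℂ →L[ℝ] ℝ))
      (2 • innerSL ℝ : ℂ →L[ℝ] ℂ →L[ℝ] ℝ) z := by
    have := ((2 • innerSL ℝ : ℂ →L[ℝ] ℂ →L[ℝ] ℝ).hasFDerivAt (x := z - a)).comp z
      ((hasFDerivAt_id z).sub_const a)
    simpa [Function.comp_def] using this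
  have h3 := (hφ'.comp_hasFDerivAt z (hsq z)).smul h2
  have := hasMeanLaplacianAt_of_hasFDerivAt h1 h3
  convert this using 1
  have e : ‖z - a‖ ^ 2 = (z - a).re ^ 2 + (z - a).im ^ 2 := by
    rw [← Complex.normSq_eq_norm_sq, Complex.normSq_apply]; ring
  have i1 : (innerSL ℝ : ℂ →L[ℝ] ℂ →L[ℝ] ℝ) 1 1 = 1 := by
    change inner ℝ (1 : ℂ) 1 = 1
    simp
  have i2 : (innerSL ℝ : ℂ →L[ℝ] ℂ →L[ℝ] ℝ) Complex.I Complex.I = 1 := by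
    change inner ℝ Complex.I Complex.I = 1
    simp
  simp [Complex.inner, i1, i2]
  rw [e]
  simp
  ring

/-! ### The Poisson integral and Weyl's lemma -/

open Metric InnerProductSpace in
lemma _root_.InnerProductSpace.HarmonicAt.hasMeanLaplacianAt {u : ℂ → ℝ} {z : ℂ}
    (h : HarmonicAt u z) : HasMeanLaplacianAt u 0 z := by
  have := hasMeanLaplacianAt_of_contDiffAt h.1
  rwa [h.2.self_of_nhds] at this

open Classical in
/-- The Poisson extension of boundary values on the circle `∂B(c, R)`: the Poisson integral inside
the disc, and `φ` itself elsewhere, so that it is continuous on the closed disc. -/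
noncomputable def poissonExt (φ : ℂ → ℝ) (c : ℂ) (R : ℝ) (z : ℂ) : ℝ :=
  if z ∈ Metric.ball c R then Real.circleAverage (poissonKernel c z • φ) c R else φ z

section Poisson

open Metric InnerProductSpace

variable {φ ψ : ℂ → ℝ} {c z : ℂ} {R M m : ℝ}

lemma poissonExt_of_mem (hz : z ∈ ball c R) :
    poissonExt φ c R z = Real.circleAverage (poissonKernel c z • φ) c R := if_pos hz

lemma poissonExt_sphere (hz : z ∈ sphere c R) : poissonExt φ c R z = φ z :=
  if_neg fun h => (mem_ball.1 h).ne (mem_sphere.1 hz)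

lemma continuousOn_poissonKernel (hz : z ∈ ball c R) :
    ContinuousOn (poissonKernel c z) (sphere c R) := by
  unfold poissonKernel
  refine ContinuousOn.div (by fun_prop) (by fun_prop) fun w hw => ?_
  have : w ≠ z := by
    rintro rfl
    exact (mem_ball.1 hz).ne (mem_sphere.1 hw)
  simpa [sub_eq_zero] using this

lemma poissonKernel_nonneg {w : ℂ} (hz : z ∈ ball c R) (hw : w ∈ sphere c R) :
    0 ≤ poissonKernel c z w := by
  rw [mem_ball_iff_norm] at hz
  rw [mem_sphere_iff_norm] at hw
  refine div_nonneg ?_ (by positivity)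
  rw [hw]
  nlinarith [norm_nonneg (z - c)]

lemma circleIntegrable_poissonKernel_smul (hz : z ∈ ball c R) (hφ : ContinuousOn φ (sphere c R)) :
    CircleIntegrable (poissonKernel c z • φ) c R := by
  refine ContinuousOn.circleIntegrable' ?_
  rw [abs_of_pos (pos_of_mem_ball hz)]
  exact (continuousOn_poissonKernel hz).smul hφ

lemma poissonExt_eq_of_harmonic {h : ℂ → ℝ} (hh : HarmonicOnNhd h (closedBall c R)) :
    poissonExt h c R z = h z := by
  by_cases hz' : z ∈ ball c R
  · rw [poissonExt_of_mem hz', hh.circleAverage_poissonKernel_smul hz']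
  · exact if_neg hz'

lemma poissonExt_mono (hφ : ContinuousOn φ (sphere c R)) (hψ : ContinuousOn ψ (sphere c R))
    (h : ∀ w ∈ sphere c R, φ w ≤ ψ w) (hz : z ∈ closedBall c R) :
    poissonExt φ c R z ≤ poissonExt ψ c R z := by
  by_cases hz' : z ∈ ball c R
  · rw [poissonExt_of_mem hz', poissonExt_of_mem hz']
    refine Real.circleAverage_mono (circleIntegrable_poissonKernel_smul hz' hφ)
      (circleIntegrable_poissonKernel_smul hz' hψ) fun w hw => ?_
    rw [abs_of_pos (pos_of_mem_ball hz')] at hw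
    exact mul_le_mul_of_nonneg_left (h w hw) (poissonKernel_nonneg hz' hw)
  · have hz2 : z ∈ sphere c R := by
      rw [mem_sphere]; rw [mem_ball, not_lt] at hz'
      exact le_antisymm hz hz'
    rw [poissonExt_sphere hz2, poissonExt_sphere hz2]
    exact h z hz2

lemma poissonExt_const (a : ℝ) : poissonExt (fun _ => a) c R z = a :=
  poissonExt_eq_of_harmonic (harmonicOnNhd_const a)

lemma poissonExt_le (hφ : ContinuousOn φ (sphere c R)) (h : ∀ w ∈ sphere c R, φ w ≤ M)
    (hz : z ∈ closedBall c R) : poissonExt φ c R z ≤ M :=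
  (poissonExt_mono hφ continuousOn_const h hz).trans_eq (poissonExt_const M)

lemma poissonExt_sub (hφ : ContinuousOn φ (sphere c R)) (hψ : ContinuousOn ψ (sphere c R)) :
    poissonExt (fun w => φ w - ψ w) c R z = poissonExt φ c R z - poissonExt ψ c R z := by
  by_cases hz : z ∈ ball c R
  · rw [poissonExt_of_mem hz, poissonExt_of_mem hz, poissonExt_of_mem hz,
      ← Real.circleAverage_sub (circleIntegrable_poissonKernel_smul hz hφ)
        (circleIntegrable_poissonKernel_smul hz hψ), ← smul_sub]
    rfl
  · simp [poissonExt, hz]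

lemma poissonExt_neg (hφ : ContinuousOn φ (sphere c R)) :
    poissonExt (fun w => - φ w) c R z = - poissonExt φ c R z := by
  have := poissonExt_sub (z := z) (continuousOn_const (c := (0 : ℝ))) hφ
  rw [poissonExt_const 0] at this
  simpa using this

lemma abs_poissonExt_le (hφ : ContinuousOn φ (sphere c R)) (h : ∀ w ∈ sphere c R, |φ w| ≤ M)
    (hz : z ∈ closedBall c R) : |poissonExt φ c R z| ≤ M := by
  refine abs_le'.2 ⟨poissonExt_le hφ (fun w hw => (abs_le'.1 (h w hw)).1) hz, ?_⟩
  rw [← poissonExt_neg hφ]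
  exact poissonExt_le hφ.neg (fun w hw => (abs_le'.1 (h w hw)).2) hz

/-- The Poisson integral is harmonic, being the real part of the holomorphic Herglotz-Riesz
integral. -/
lemma harmonicAt_poissonExt (hφ : ContinuousOn φ (sphere c R)) (hz : z ∈ ball c R) :
    HarmonicAt (poissonExt φ c R) z := by
  have hR : 0 < R := pos_of_mem_ball hz
  set g : ℂ → ℝ := fun ζ => φ (ζ + c) with hg
  have hgc : ContinuousOn g (sphere 0 R) := by
    refine hφ.comp (by fun_prop) fun ζ hζ => ?_
    simpa using hζ
  have hgi : CircleIntegrable g 0 R := by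
    refine ContinuousOn.circleIntegrable' ?_
    rwa [abs_of_pos hR]
  have hgi' : CircleIntegrable (fun ζ => (g ζ : ℂ)) 0 R := by
    refine ContinuousOn.circleIntegrable' ?_
    rw [abs_of_pos hR]
    exact Complex.continuous_ofReal.comp_continuousOn hgc
  have key : ∀ w ∈ ball c R, poissonExt φ c R w = (Real.circleAverage
      (fun ζ ↦ herglotzRieszKernel 0 (w - c) ζ • (g ζ : ℂ)) 0 R).re := by
    intro w hw
    rw [re_circleAverage_herglotzRieszKernel_smul hgi (by simpa [dist_eq_norm] using hw),
      poissonExt_of_mem hw,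
      ← Real.circleAverage_map_add_const]
    congr 1
    ext ζ
    simp [poissonKernel_eq_re_herglotzRieszKernel, herglotzRieszKernel_add_const, hg]
  have han : AnalyticAt ℂ (fun w => Real.circleAverage
      (fun ζ ↦ herglotzRieszKernel 0 (w - c) ζ • (g ζ : ℂ)) 0 R) z := by
    have h0 := analyticOnNhd_circleAverage_herglotzRieszKernel_smul hgi' (z - c)
      (by simpa [dist_eq_norm] using hz)
    exact AnalyticAt.comp (f := fun w => w - c) h0 (analyticAt_id.sub analyticAt_const)
  refine (harmonicAt_congr_nhds ?_).2 han.harmonicAt_re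
  filter_upwards [isOpen_ball.mem_nhds hz] with w hw using key w hw

/-- On the circle, `‖w - ζ‖ ^ 2` coincides with the harmonic function on the right hand side, which
vanishes at `w = ζ`; it serves as a barrier at the boundary point `ζ`. -/
lemma norm_sub_sq_of_mem_sphere {w ζ : ℂ} (hw : w ∈ sphere c R) (hζ : ζ ∈ sphere c R) :
    ‖w - ζ‖ ^ 2 = 2 * (R ^ 2 - inner ℝ (ζ - c) (w - c)) := by
  rw [mem_sphere_iff_norm] at hw hζ
  rw [show w - ζ = (w - c) - (ζ - c) by ring, norm_sub_sq_real, hw, hζ, real_inner_comm]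
  ring

lemma harmonicOnNhd_barrier (ζ : ℂ) (a K : ℝ) (s : Set ℂ) :
    HarmonicOnNhd (fun w => a + K * (2 * (R ^ 2 - inner ℝ (ζ - c) (w - c)))) s := by
  intro w _
  have : AnalyticAt ℂ
      (fun w => (a : ℂ) + K * (2 * (R ^ 2 - (starRingEnd ℂ) (ζ - c) * (w - c)))) w := by
    fun_prop
  convert! this.harmonicAt_re using 1
  ext w
  simp [Complex.inner, pow_two]
  left
  ring

/-- Upper semicontinuity of the Poisson extension at a boundary point, by comparison with a harmonic
barrier. -/
lemma eventually_poissonExt_le (hφ : ContinuousOn φ (sphere c R)) {ζ : ℂ}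
    (hζ : ζ ∈ sphere c R) {ε : ℝ} (hε : 0 < ε) :
    ∀ᶠ w in 𝓝[closedBall c R] ζ, poissonExt φ c R w ≤ φ ζ + ε := by
  -- on the circle, `φ ≤ φ ζ + ε / 2 + K ‖w - ζ‖ ^ 2` for a suitable `K`
  obtain ⟨M, hM⟩ := (isCompact_sphere c R).bddAbove_image hφ
  have hM' : ∀ w ∈ sphere c R, φ w ≤ M := fun w hw => hM (mem_image_of_mem _ hw)
  obtain ⟨δ, hδ, H⟩ := Metric.continuousWithinAt_iff.1 (hφ ζ hζ) (ε / 2) (by positivity)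
  set K := (M - φ ζ) / δ ^ 2 with hK
  have hK0 : 0 ≤ K := div_nonneg (sub_nonneg.2 (hM' ζ hζ)) (by positivity)
  have hle : ∀ w ∈ sphere c R,
      φ w ≤ (φ ζ + ε / 2) + K * (2 * (R ^ 2 - inner ℝ (ζ - c) (w - c))) := by
    intro w hw
    rw [← norm_sub_sq_of_mem_sphere hw hζ]
    by_cases hd : dist w ζ < δ
    · have h1 := (abs_lt.1 (Real.dist_eq _ _ ▸ H hw hd)).2
      have : 0 ≤ K * ‖w - ζ‖ ^ 2 := by positivity
      linarith
    · rw [not_lt, dist_eq_norm] at hd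
      have h1 : δ ^ 2 ≤ ‖w - ζ‖ ^ 2 := by gcongr
      have h2 : K * δ ^ 2 = M - φ ζ := by rw [hK]; field_simp
      have h3 := hM' w hw
      have h4 := mul_le_mul_of_nonneg_left h1 hK0
      linarith
  have hc : ContinuousAt
      (fun w => (φ ζ + ε / 2) + K * (2 * (R ^ 2 - inner ℝ (ζ - c) (w - c)))) ζ := by
    fun_prop
  have hval : (φ ζ + ε / 2) + K * (2 * (R ^ 2 - inner ℝ (ζ - c) (ζ - c))) < φ ζ + ε := by
    rw [← norm_sub_sq_of_mem_sphere hζ hζ]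
    simp
    linarith
  filter_upwards [(hc.eventually_lt_const hval).filter_mono nhdsWithin_le_nhds,
    self_mem_nhdsWithin] with w hw hw'
  refine le_trans ?_ hw.le
  have hb := harmonicOnNhd_barrier (c := c) (R := R) ζ (φ ζ + ε / 2) K (closedBall c R)
  exact (poissonExt_mono hφ (hb.continuousOn.mono sphere_subset_closedBall) hle hw').trans_eq
    (poissonExt_eq_of_harmonic hb)

lemma continuousOn_poissonExt (hφ : ContinuousOn φ (sphere c R)) :
    ContinuousOn (poissonExt φ c R) (closedBall c R) := by
  intro ζ hζ
  by_cases hζ' : ζ ∈ ball c R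
  · exact (harmonicAt_poissonExt hφ hζ').1.continuousAt.continuousWithinAt
  · have hζ2 : ζ ∈ sphere c R := by
      rw [mem_sphere]; rw [mem_ball, not_lt] at hζ'
      exact le_antisymm hζ hζ'
    rw [ContinuousWithinAt, Metric.tendsto_nhds]
    intro ε hε
    filter_upwards [eventually_poissonExt_le hφ hζ2 (half_pos hε),
      eventually_poissonExt_le hφ.neg hζ2 (half_pos hε), self_mem_nhdsWithin] with w h1 h2 h3
    change poissonExt (fun w => - φ w) c R w ≤ - φ ζ + ε / 2 at h2
    rw [poissonExt_neg hφ] at h2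
    rw [poissonExt_sphere hζ2, Real.dist_eq, abs_lt]
    constructor <;> linarith

lemma abs_poissonKernel_sub_one_le {w : ℂ} (hR : 0 < R) (hz : ‖z - c‖ ≤ R / 2)
    (hw : w ∈ sphere c R) : |poissonKernel c z w - 1| ≤ 4 / R * ‖z - c‖ := by
  have hzb : z ∈ ball c R := by rw [mem_ball_iff_norm]; linarith
  have h1 := re_herglotzRieszKernel_le hw hzb
  have h2 := le_re_herglotzRieszKernel hw hzb
  have e : poissonKernel c z w = ((w - c + (z - c)) / ((w - c) - (z - c))).re := by
    rw [poissonKernel_eq_re_herglotzRieszKernel]; rfl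
  rw [e]
  have h0 := norm_nonneg (z - c)
  have h3 : (R + ‖z - c‖) / (R - ‖z - c‖) ≤ 1 + 4 / R * ‖z - c‖ := by
    rw [div_le_iff₀ (by linarith)]
    field_simp
    nlinarith
  have h4 : 1 - 4 / R * ‖z - c‖ ≤ (R - ‖z - c‖) / (R + ‖z - c‖) := by
    rw [le_div_iff₀ (by linarith)]
    field_simp
    nlinarith
  rw [abs_le]
  constructor <;> linarith

lemma abs_poissonExt_sub_center_le (hR : 0 < R) (hφ : ContinuousOn φ (sphere c R))
    (h : ∀ w ∈ sphere c R, |φ w| ≤ M) (hz : ‖z - c‖ ≤ R / 2) :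
    |poissonExt φ c R z - poissonExt φ c R c| ≤ 4 / R * M * ‖z - c‖ := by
  have hzb : z ∈ ball c R := by rw [mem_ball_iff_norm]; linarith
  have hcb : c ∈ ball c R := mem_ball_self hR
  have i1 := circleIntegrable_poissonKernel_smul hzb hφ
  have i2 := circleIntegrable_poissonKernel_smul hcb hφ
  rw [poissonExt_of_mem hzb, poissonExt_of_mem hcb, ← Real.circleAverage_sub i1 i2]
  refine Real.abs_circleAverage_le_circleAverage_abs.trans ?_
  refine Real.circleAverage_mono_on_of_le_circle (i1.sub i2).abs fun w hw => ?_
  rw [abs_of_pos hR] at hw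
  have e : poissonKernel c c w = 1 := by
    rw [mem_sphere_iff_norm] at hw
    simp [poissonKernel, hw, hR.ne']
  have h1 := abs_poissonKernel_sub_one_le hR hz hw
  simp only [Pi.abs_apply, Pi.sub_apply, smul_eq_mul, Pi.mul_apply, e, one_mul]
  rw [show poissonKernel c z w * φ w - φ w = (poissonKernel c z w - 1) * φ w by ring, abs_mul]
  calc _ ≤ (4 / R * ‖z - c‖) * M := by
        gcongr
        exact h w hw
    _ = _ := by ring

end Poisson

section Comparison

open Metric InnerProductSpace

variable {u v : ℂ → ℝ} {c : ℂ} {R : ℝ}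

lemma eventually_continuousAt_of_mem_ball {z : ℂ} (hu : ContinuousOn u (closedBall c R))
    (hz : z ∈ ball c R) : ∀ᶠ w in 𝓝 z, ContinuousAt u w := by
  filter_upwards [isOpen_ball.mem_nhds hz] with w hw
  exact hu.continuousAt (mem_of_superset (isOpen_ball.mem_nhds hw) ball_subset_closedBall)

/-- If `u - v` exceeds its boundary bound `a` on a disc, it has an interior maximum with value
exceeding `a`. -/
lemma exists_isLocalMax_of_lt (hu : ContinuousOn u (closedBall c R))
    (hv : ContinuousOn v (closedBall c R)) {a : ℝ} (hb : ∀ w ∈ sphere c R, u w - v w ≤ a)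
    {z : ℂ} (hz : z ∈ closedBall c R) (hza : a < u z - v z) :
    ∃ x ∈ ball c R, a < u x - v x ∧ ∀ᶠ w in 𝓝 x, u w - v w ≤ u x - v x := by
  obtain ⟨x, hx, hmax⟩ := (isCompact_closedBall c R).exists_isMaxOn ⟨z, hz⟩ (hu.sub hv)
  have hax : a < u x - v x := hza.trans_le (hmax hz)
  have hxb : x ∈ ball c R := by
    by_contra hxb
    have : x ∈ sphere c R := by
      rw [mem_sphere]; rw [mem_ball, not_lt] at hxb
      exact le_antisymm hx hxb
    exact absurd (hb x this) (not_le.2 hax)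
  refine ⟨x, hxb, hax, ?_⟩
  filter_upwards [isOpen_ball.mem_nhds hxb] with w hw
  exact hmax (ball_subset_closedBall hw)

lemma hasMeanLaplacianAt_mul_norm_sq (a : ℂ) (ε : ℝ) (z : ℂ) :
    HasMeanLaplacianAt (fun w => ε * ‖w - a‖ ^ 2) (4 * ε) z := by
  have := hasMeanLaplacianAt_radial (φ := fun t => ε * t) (φ' := fun _ => ε) (φ'' := 0)
    (a := a) (z := z)
    (Eventually.of_forall fun t => by simpa using (hasDerivAt_id t).const_mul ε)
    (hasDerivAt_const _ _)
  simpa using this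

lemma le_poissonExt_of_hasMeanLaplacianAt_zero (hR : 0 < R)
    (hu : ContinuousOn u (closedBall c R)) (hL : ∀ z ∈ ball c R, HasMeanLaplacianAt u 0 z)
    {z : ℂ} (hz : z ∈ closedBall c R) : u z ≤ poissonExt u c R z := by
  have hφ := hu.mono sphere_subset_closedBall
  have hP := continuousOn_poissonExt hφ
  refine le_of_forall_pos_le_add fun ε hε => ?_
  by_contra! hlt
  -- adding a small multiple of `‖w - c‖ ^ 2` makes the Laplacian of `u` strictly positive
  set η := ε / R ^ 2 with hη
  have hη0 : 0 < η := by positivity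
  have hq : ContinuousOn (fun w => η * ‖w - c‖ ^ 2) (closedBall c R) := by fun_prop
  have huq : ContinuousOn (fun w => u w + η * ‖w - c‖ ^ 2) (closedBall c R) := hu.add hq
  obtain ⟨x, hx, -, hmax⟩ := exists_isLocalMax_of_lt huq hP (a := ε)
    (fun w hw => by
      rw [poissonExt_sphere hw]
      rw [mem_sphere_iff_norm] at hw
      rw [hw, hη]
      field_simp
      simp)
    hz (by have : 0 ≤ η * ‖z - c‖ ^ 2 := by positivity
           linarith)
  have h1 := lowerLaplacian_le_of_isLocalMax hmax
    (harmonicAt_poissonExt hφ hx).hasMeanLaplacianAt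
    (eventually_continuousAt_of_mem_ball huq hx) (eventually_continuousAt_of_mem_ball hP hx)
  rw [((hL x hx).add (hasMeanLaplacianAt_mul_norm_sq c η x)
    (eventually_continuousAt_of_mem_ball hu hx)
    (eventually_continuousAt_of_mem_ball hq hx)).lowerLaplacian_eq, EReal.coe_le_coe_iff] at h1
  linarith

/-- Weyl's lemma: a continuous function whose generalized Laplacian vanishes is the Poisson
integral of its boundary values. -/
theorem eq_poissonExt_of_hasMeanLaplacianAt_zero (hR : 0 < R)
    (hu : ContinuousOn u (closedBall c R)) (hL : ∀ z ∈ ball c R, HasMeanLaplacianAt u 0 z)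
    {z : ℂ} (hz : z ∈ closedBall c R) : u z = poissonExt u c R z := by
  refine le_antisymm (le_poissonExt_of_hasMeanLaplacianAt_zero hR hu hL hz) ?_
  have h := le_poissonExt_of_hasMeanLaplacianAt_zero (u := fun w => - u w) hR hu.neg
    (fun z hz => by simpa using (hL z hz).const_mul (-1)) hz
  rw [poissonExt_neg (hu.mono sphere_subset_closedBall)] at h
  linarith

end Comparison

/-! ### The logarithmic potential of a bounded function -/

section Potential

open MeasureTheory Metric

/-- `f` is a measurable function, bounded by `M` and vanishing outside the closed disc of centre `c`
and radius `R`. -/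
structure IsBoundedOnDisc {E : Type*} [NormedAddCommGroup E] (f : ℂ → E) (c : ℂ) (R M : ℝ) :
    Prop where
  aestronglyMeasurable : AEStronglyMeasurable f volume
  norm_le : ∀ w, ‖f w‖ ≤ M
  eq_zero : ∀ w ∉ closedBall c R, f w = 0

/-- The logarithmic potential of `f`, without the usual factor `1 / 2π`. -/
noncomputable def logPotential {E : Type*} [NormedAddCommGroup E] [NormedSpace ℝ E] (f : ℂ → E)
    (z : ℂ) : E :=
  ∫ w, Real.log ‖z - w‖ • f w

/-- The smooth regularization `log √(‖h‖² + ε²)` of the logarithmic kernel. -/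
noncomputable def regLog (ε : ℝ) (h : ℂ) : ℝ := Real.log (‖h‖ ^ 2 + ε ^ 2) / 2

/-- The derivative of `regLog ε`; for `ε = 0` this is the derivative of `log ‖h‖` at `h ≠ 0`
(and zero at `h = 0`). -/
noncomputable def regGrad (ε : ℝ) (h : ℂ) : ℂ →L[ℝ] ℝ := (‖h‖ ^ 2 + ε ^ 2)⁻¹ • innerSL ℝ h

lemma locallyIntegrable_norm_inv : LocallyIntegrable (fun h : ℂ => ‖h‖⁻¹) volume := by
  refine locallyIntegrable_of_norm_le_rpow (C := 1) (α := 1) (by simp) (by simp) ?_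
    (by fun_prop)
  refine Eventually.of_forall fun h => ?_
  simp [Real.rpow_neg_one]

lemma locallyIntegrable_norm_inv_mul_sqrt_inv :
    LocallyIntegrable (fun h : ℂ => ‖h‖⁻¹ * (√‖h‖)⁻¹) volume := by
  refine locallyIntegrable_of_norm_le_rpow (C := 1) (α := 3 / 2) (by simp) (by norm_num) ?_
    (by fun_prop)
  refine Eventually.of_forall fun h => ?_
  rw [Real.norm_of_nonneg (by positivity), one_mul, Real.rpow_neg (norm_nonneg h),
    show (3 / 2 : ℝ) = 1 + 1 / 2 by norm_num, Real.rpow_add' (norm_nonneg h) (by norm_num),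
    Real.rpow_one, ← Real.sqrt_eq_rpow, mul_inv]

lemma abs_log_le_inv_add {t : ℝ} (ht : 0 ≤ t) : |Real.log t| ≤ t⁻¹ + t := by
  have h1 := Real.log_le_self ht
  have h2 := Real.log_le_self (inv_nonneg.2 ht)
  have h3 := inv_nonneg.2 ht
  rw [Real.log_inv] at h2
  rw [abs_le]
  constructor <;> linarith

lemma locallyIntegrable_log_norm : LocallyIntegrable (fun h : ℂ => Real.log ‖h‖) volume := by
  refine (locallyIntegrable_norm_inv.add
    (continuous_norm.locallyIntegrable (X := ℂ))).mono
    (Measurable.aestronglyMeasurable (by fun_prop)) (Eventually.of_forall fun h => ?_)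
  rw [Real.norm_eq_abs]
  exact (abs_log_le_inv_add (norm_nonneg h)).trans (le_abs_self _)

lemma hasFDerivAt_regLog {ε : ℝ} (hε : 0 < ε) (h : ℂ) :
    HasFDerivAt (regLog ε) (regGrad ε h) h := by
  have h1 : HasFDerivAt (fun h : ℂ => ‖h‖ ^ 2 + ε ^ 2) (2 • innerSL ℝ h) h := by
    simpa using (hasFDerivAt_id h).norm_sq.add_const (ε ^ 2)
  have h2 := (h1.log (by positivity)).mul_const (1 / 2)
  have h3 : regLog ε = fun h => Real.log (‖h‖ ^ 2 + ε ^ 2) * (1 / 2) := by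
    ext h; simp [regLog, div_eq_mul_inv]
  rw [h3]
  refine h2.congr_fderiv (ContinuousLinearMap.ext fun v => ?_)
  simp [regGrad]
  ring

lemma norm_regGrad_eq (ε : ℝ) (h : ℂ) : ‖regGrad ε h‖ = ‖h‖ / (‖h‖ ^ 2 + ε ^ 2) := by
  rw [regGrad, norm_smul, innerSL_apply_norm, norm_inv, Real.norm_of_nonneg (by positivity)]
  ring

lemma norm_regGrad_le {ε : ℝ} (hε : 0 < ε) (h : ℂ) : ‖regGrad ε h‖ ≤ ε⁻¹ := by
  rw [norm_regGrad_eq, div_le_iff₀ (by positivity)]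
  field_simp
  nlinarith [norm_nonneg h, sq_nonneg (‖h‖ - ε)]

lemma norm_regGrad_zero_le (h : ℂ) : ‖regGrad 0 h‖ ≤ ‖h‖⁻¹ := by
  rw [norm_regGrad_eq]
  rcases eq_or_ne h 0 with rfl | hh
  · simp
  · have := norm_pos_iff.2 hh
    apply le_of_eq
    field_simp
    simp

lemma norm_regGrad_sub_le {ε : ℝ} (hε : 0 < ε) (h : ℂ) :
    ‖regGrad ε h - regGrad 0 h‖ ≤ √ε * (‖h‖⁻¹ * (√‖h‖)⁻¹) := by
  rcases eq_or_ne h 0 with rfl | hh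
  · simp [regGrad]
  have ht : 0 < ‖h‖ := norm_pos_iff.2 hh
  have e0 : regGrad ε h - regGrad 0 h
      = ((‖h‖ ^ 2 + ε ^ 2)⁻¹ - (‖h‖ ^ 2 + 0 ^ 2)⁻¹) • innerSL ℝ h := by
    refine ContinuousLinearMap.ext fun v => ?_
    simp [regGrad, sub_mul]
  rw [e0, norm_smul, innerSL_apply_norm, Real.norm_eq_abs, abs_sub_comm, abs_of_nonneg]
  · obtain ⟨b, hb, hb'⟩ : ∃ b > 0, ‖h‖ = b ^ 2 := ⟨√‖h‖, by positivity, (Real.sq_sqrt ht.le).symm⟩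
    obtain ⟨a, ha, rfl⟩ : ∃ a > 0, ε = a ^ 2 := ⟨√ε, by positivity, (Real.sq_sqrt hε.le).symm⟩
    rw [hb', Real.sqrt_sq hb.le, Real.sqrt_sq ha.le]
    have key : a ^ 3 * b ≤ b ^ 4 + a ^ 4 := by
      rcases le_total a b with hab | hab
      · have : a ^ 3 * b ≤ b ^ 3 * b := by gcongr
        nlinarith [pow_pos ha 4]
      · have : a ^ 3 * b ≤ a ^ 3 * a := by gcongr
        nlinarith [pow_pos hb 4]
    have e : (((b ^ 2) ^ 2 + 0 ^ 2)⁻¹ - ((b ^ 2) ^ 2 + (a ^ 2) ^ 2)⁻¹) * b ^ 2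
        = a ^ 4 / ((b ^ 4 + a ^ 4) * b ^ 2) := by
      field_simp
      ring
    rw [e, div_le_iff₀ (by positivity)]
    have e2 : a * ((b ^ 2)⁻¹ * b⁻¹) * ((b ^ 4 + a ^ 4) * b ^ 2) = a * (b ^ 4 + a ^ 4) / b := by
      field_simp
    rw [e2, le_div_iff₀ hb]
    nlinarith
  · rw [sub_nonneg]
    gcongr

lemma abs_regLog_sub_le {ε : ℝ} (hε : 0 < ε) {h : ℂ} (hh : h ≠ 0) :
    |regLog ε h - Real.log ‖h‖| ≤ ε * ‖h‖⁻¹ := by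
  have ht : 0 < ‖h‖ := norm_pos_iff.2 hh
  have h1 : Real.log (‖h‖ ^ 2) ≤ Real.log (‖h‖ ^ 2 + ε ^ 2) :=
    Real.log_le_log (by positivity) (by nlinarith)
  have h2 : Real.log (‖h‖ ^ 2 + ε ^ 2) ≤ Real.log ((‖h‖ + ε) ^ 2) :=
    Real.log_le_log (by positivity) (by nlinarith)
  rw [Real.log_pow] at h1 h2
  have h3 : Real.log (‖h‖ + ε) - Real.log ‖h‖ ≤ ε * ‖h‖⁻¹ := by
    rw [← Real.log_div (by positivity) (by positivity)]
    refine (Real.log_le_sub_one_of_pos (by positivity)).trans (le_of_eq ?_)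
    field_simp
    ring
  push_cast at h1 h2
  rw [regLog, abs_of_nonneg (by linarith)]
  linarith

lemma measurable_regGrad (ε : ℝ) : StronglyMeasurable (regGrad ε) := by
  have h1 : StronglyMeasurable fun h : ℂ => (‖h‖ ^ 2 + ε ^ 2)⁻¹ :=
    Measurable.stronglyMeasurable (by fun_prop)
  exact h1.smul (innerSL ℝ : ℂ →L[ℝ] ℂ →L[ℝ] ℝ).continuous.stronglyMeasurable

lemma continuous_regGrad {ε : ℝ} (hε : 0 < ε) : Continuous (regGrad ε) := by
  have h1 : Continuous fun h : ℂ => (‖h‖ ^ 2 + ε ^ 2)⁻¹ :=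
    Continuous.inv₀ (by fun_prop) fun h => by positivity
  exact h1.smul (innerSL ℝ : ℂ →L[ℝ] ℂ →L[ℝ] ℝ).continuous

variable {E : Type*} [NormedAddCommGroup E] {f : ℂ → E} {c z : ℂ} {R M ρ : ℝ} {k : ℂ → ℝ}

namespace IsBoundedOnDisc

lemma nonneg (hf : IsBoundedOnDisc f c R M) : 0 ≤ M := (norm_nonneg _).trans (hf.norm_le 0)

lemma kernel_le (hf : IsBoundedOnDisc f c R M) (hz : ‖z - c‖ + R < ρ) (w : ℂ) :
    ‖k (z - w)‖ * ‖f w‖ ≤ M * (ball 0 ρ).indicator (fun h => ‖k h‖) (z - w) := by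
  by_cases hw : w ∈ closedBall c R
  · have : z - w ∈ ball (0 : ℂ) ρ := by
      rw [mem_ball_zero_iff]
      rw [mem_closedBall_iff_norm'] at hw
      calc ‖z - w‖ = ‖(z - c) + (c - w)‖ := by congr 1; ring
        _ ≤ _ := norm_add_le _ _
        _ < ρ := by linarith
    rw [indicator_of_mem this, mul_comm]
    gcongr
    exact hf.norm_le w
  · rw [hf.eq_zero w hw, norm_zero, mul_zero]
    exact mul_nonneg hf.nonneg (indicator_nonneg (fun _ _ => norm_nonneg _) _)

lemma integrable_bound (hk : LocallyIntegrable k volume) (M : ℝ) (z : ℂ) (ρ : ℝ) :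
    Integrable (fun w => M * (ball 0 ρ).indicator (fun h => ‖k h‖) (z - w)) := by
  have : IntegrableOn (fun h => ‖k h‖) (ball 0 ρ) :=
    ((hk.integrableOn_isCompact (isCompact_closedBall 0 ρ)).mono_set ball_subset_closedBall).norm
  exact ((integrable_indicator_iff measurableSet_ball).2 this).comp_sub_left z |>.const_mul M

lemma integrable_kernel (hf : IsBoundedOnDisc f c R M) (hk : LocallyIntegrable k volume) (z : ℂ) :
    Integrable (fun w => ‖k (z - w)‖ * ‖f w‖) := by
  refine (integrable_bound hk M z (‖z - c‖ + R + 1)).mono' ?_ (Eventually.of_forall fun w => ?_)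
  · refine AEStronglyMeasurable.mul ?_ hf.aestronglyMeasurable.norm
    exact (hk.aestronglyMeasurable.comp_quasiMeasurePreserving
      (quasiMeasurePreserving_sub_left volume z)).norm
  · rw [Real.norm_of_nonneg (by positivity)]
    exact hf.kernel_le (by linarith) w

/-- A bound, uniform for `z` in a disc, for integrals against a locally integrable kernel. -/
lemma integral_kernel_le (hf : IsBoundedOnDisc f c R M) (hk : LocallyIntegrable k volume)
    (hz : ‖z - c‖ + R < ρ) :
    ∫ w, ‖k (z - w)‖ * ‖f w‖ ≤ M * ∫ h in ball 0 ρ, ‖k h‖ := by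
  calc ∫ w, ‖k (z - w)‖ * ‖f w‖
      ≤ ∫ w, M * (ball 0 ρ).indicator (fun h => ‖k h‖) (z - w) :=
        integral_mono (hf.integrable_kernel hk z) (integrable_bound hk M z ρ) (hf.kernel_le hz)
    _ = M * ∫ h in ball 0 ρ, ‖k h‖ := by
        rw [integral_const_mul, integral_sub_left_eq_self
          ((ball 0 ρ).indicator (fun h => ‖k h‖)), integral_indicator measurableSet_ball]

lemma integrable (hf : IsBoundedOnDisc f c R M) : Integrable f := by
  have : IntegrableOn f (closedBall c R) :=
    Measure.integrableOn_of_bounded (M := M) (isCompact_closedBall c R).measure_lt_top.ne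
      hf.aestronglyMeasurable (Eventually.of_forall hf.norm_le)
  rwa [integrableOn_iff_integrable_of_support_subset] at this
  intro w hw
  by_contra h
  exact hw (hf.eq_zero w h)

variable [NormedSpace ℝ E]

lemma integrable_log (hf : IsBoundedOnDisc f c R M) (z : ℂ) :
    Integrable (fun w => Real.log ‖z - w‖ • f w) := by
  refine (hf.integrable_kernel locallyIntegrable_log_norm z).mono' ?_
    (Eventually.of_forall fun w => by rw [norm_smul])
  exact AEStronglyMeasurable.smul (Measurable.aestronglyMeasurable (by fun_prop))
    hf.aestronglyMeasurable

lemma norm_logPotential_le (hf : IsBoundedOnDisc f c R M) (hz : ‖z - c‖ + R < ρ) :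
    ‖logPotential f z‖ ≤ M * ∫ h : ℂ in ball 0 ρ, ‖Real.log ‖h‖‖ := by
  refine le_trans ?_ (hf.integral_kernel_le locallyIntegrable_log_norm hz)
  refine (norm_integral_le_integral_norm _).trans (le_of_eq ?_)
  simp only [norm_smul]

end IsBoundedOnDisc

variable [NormedSpace ℝ E]

/-- The gradient of the logarithmic potential of `f`, regularized by `ε`; `ε = 0` gives the potential
itself. -/
noncomputable def potGrad (ε : ℝ) (f : ℂ → E) (z : ℂ) : ℂ →L[ℝ] E :=
  ∫ w, (regGrad ε (z - w)).smulRight (f w)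

namespace IsBoundedOnDisc

lemma aestronglyMeasurable_grad (hf : IsBoundedOnDisc f c R M) (ε : ℝ) (z : ℂ) :
    AEStronglyMeasurable (fun w => (regGrad ε (z - w)).smulRight (f w)) volume := by
  have h1 : AEStronglyMeasurable (fun w => regGrad ε (z - w)) volume :=
    ((measurable_regGrad ε).comp_measurable (by fun_prop)).aestronglyMeasurable
  exact (ContinuousLinearMap.smulRightL ℝ ℂ E).aestronglyMeasurable_comp₂ h1
    hf.aestronglyMeasurable

lemma hasFDerivAt_regLog (hf : IsBoundedOnDisc f c R M) {ε : ℝ} (hε : 0 < ε) (z : ℂ) :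
    HasFDerivAt (fun z => ∫ w, regLog ε (z - w) • f w) (potGrad ε f z) z := by
  have hcont : Continuous (regLog ε) :=
    continuous_iff_continuousAt.2 fun h => (SKMetric.hasFDerivAt_regLog hε h).continuousAt
  refine hasFDerivAt_integral_of_dominated_of_fderiv_le (bound := fun w => ε⁻¹ * ‖f w‖)
    (F' := fun z w => (regGrad ε (z - w)).smulRight (f w)) univ_mem ?_ ?_
    (hf.aestronglyMeasurable_grad ε z) ?_ (hf.integrable.norm.const_mul _) ?_
  · refine Eventually.of_forall fun z => ?_
    exact AEStronglyMeasurable.smul (hcont.comp (by fun_prop)).aestronglyMeasurable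
      hf.aestronglyMeasurable
  · refine (hf.integrable_kernel (k := regLog ε) hcont.locallyIntegrable z).mono' ?_
      (Eventually.of_forall fun w => by rw [norm_smul])
    exact AEStronglyMeasurable.smul (hcont.comp (by fun_prop)).aestronglyMeasurable
      hf.aestronglyMeasurable
  · refine Eventually.of_forall fun w z _ => ?_
    rw [ContinuousLinearMap.norm_smulRight_apply]
    gcongr
    exact norm_regGrad_le hε _
  · refine Eventually.of_forall fun w z _ => ?_
    have h0 : HasFDerivAt (fun z : ℂ => z - w) (ContinuousLinearMap.id ℝ ℂ) z :=
      (hasFDerivAt_id z).sub_const w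
    have h1 := ((SKMetric.hasFDerivAt_regLog hε (z - w)).comp z h0).smul_const (f w)
    simpa only [ContinuousLinearMap.comp_id, Function.comp_def] using h1

lemma continuous_potGrad_reg (hf : IsBoundedOnDisc f c R M) {ε : ℝ} (hε : 0 < ε) :
    Continuous (potGrad ε f) := by
  refine continuous_of_dominated (bound := fun w => ε⁻¹ * ‖f w‖)
    (hf.aestronglyMeasurable_grad ε) (fun z => ?_) (hf.integrable.norm.const_mul _) ?_
  · refine Eventually.of_forall fun w => ?_
    rw [ContinuousLinearMap.norm_smulRight_apply]
    gcongr
    exact norm_regGrad_le hε _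
  · refine Eventually.of_forall fun w => ?_
    have h1 : Continuous fun z => regGrad ε (z - w) := (continuous_regGrad hε).comp (by fun_prop)
    exact ((ContinuousLinearMap.smulRightL ℝ ℂ E).continuous.comp h1).clm_apply continuous_const

lemma integrable_grad (hf : IsBoundedOnDisc f c R M) {ε : ℝ} (hε : 0 ≤ ε) (z : ℂ) :
    Integrable (fun w => (regGrad ε (z - w)).smulRight (f w)) := by
  rcases hε.eq_or_lt with rfl | hε
  · refine (hf.integrable_kernel locallyIntegrable_norm_inv z).mono'
      (hf.aestronglyMeasurable_grad 0 z) (Eventually.of_forall fun w => ?_)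
    rw [ContinuousLinearMap.norm_smulRight_apply]
    gcongr
    simpa using norm_regGrad_zero_le (z - w)
  · refine (hf.integrable.norm.const_mul ε⁻¹).mono'
      (hf.aestronglyMeasurable_grad ε z) (Eventually.of_forall fun w => ?_)
    rw [ContinuousLinearMap.norm_smulRight_apply]
    gcongr
    exact norm_regGrad_le hε _

lemma norm_potGrad_sub_le (hf : IsBoundedOnDisc f c R M) {ε : ℝ} (hε : 0 < ε)
    (hz : ‖z - c‖ + R < ρ) :
    ‖potGrad ε f z - potGrad 0 f z‖
      ≤ √ε * (M * ∫ h : ℂ in ball 0 ρ, ‖‖h‖⁻¹ * (√‖h‖)⁻¹‖) := by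
  rw [potGrad, potGrad, ← integral_sub (hf.integrable_grad hε.le z) (hf.integrable_grad le_rfl z)]
  have hI := (hf.integrable_kernel locallyIntegrable_norm_inv_mul_sqrt_inv z).const_mul √ε
  calc _ ≤ ∫ w, √ε * (‖‖z - w‖⁻¹ * (√‖z - w‖)⁻¹‖ * ‖f w‖) := by
        refine norm_integral_le_of_norm_le hI (Eventually.of_forall fun w => ?_)
        have e : (regGrad ε (z - w)).smulRight (f w) - (regGrad 0 (z - w)).smulRight (f w)
            = (regGrad ε (z - w) - regGrad 0 (z - w)).smulRight (f w) := by
          refine ContinuousLinearMap.ext fun v => ?_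
          simp [sub_smul]
        rw [e, ContinuousLinearMap.norm_smulRight_apply, ← mul_assoc]
        gcongr
        refine (norm_regGrad_sub_le hε (z - w)).trans ?_
        gcongr
        exact le_abs_self _
    _ ≤ _ := by
        rw [integral_const_mul]
        gcongr
        exact hf.integral_kernel_le locallyIntegrable_norm_inv_mul_sqrt_inv hz

lemma norm_potGrad_le (hf : IsBoundedOnDisc f c R M) (hz : ‖z - c‖ + R < ρ) :
    ‖potGrad 0 f z‖ ≤ M * ∫ h : ℂ in ball 0 ρ, ‖‖h‖⁻¹‖ := by
  refine le_trans ?_ (hf.integral_kernel_le locallyIntegrable_norm_inv hz)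
  refine norm_integral_le_of_norm_le (hf.integrable_kernel locallyIntegrable_norm_inv z)
    (Eventually.of_forall fun w => ?_)
  rw [ContinuousLinearMap.norm_smulRight_apply]
  gcongr
  simpa using norm_regGrad_zero_le (z - w)

lemma norm_regLog_integral_sub_le (hf : IsBoundedOnDisc f c R M) {ε : ℝ} (hε : 0 < ε)
    (hz : ‖z - c‖ + R < ρ) :
    ‖(∫ w, regLog ε (z - w) • f w) - logPotential f z‖
      ≤ ε * (M * ∫ h : ℂ in ball 0 ρ, ‖‖h‖⁻¹‖) := by
  have hcont : Continuous (regLog ε) :=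
    continuous_iff_continuousAt.2 fun h => (SKMetric.hasFDerivAt_regLog hε h).continuousAt
  have hi : Integrable (fun w => regLog ε (z - w) • f w) := by
    refine (hf.integrable_kernel (k := regLog ε) hcont.locallyIntegrable z).mono' ?_
      (Eventually.of_forall fun w => by rw [norm_smul])
    exact AEStronglyMeasurable.smul (hcont.comp (by fun_prop)).aestronglyMeasurable
      hf.aestronglyMeasurable
  rw [logPotential, ← integral_sub hi (hf.integrable_log z)]
  have hI := (hf.integrable_kernel locallyIntegrable_norm_inv z).const_mul ε
  calc _ ≤ ∫ w, ε * (‖‖z - w‖⁻¹‖ * ‖f w‖) := by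
        refine norm_integral_le_of_norm_le hI ?_
        have : ∀ᵐ w : ℂ, w ≠ z := by
          simp [ae_iff]
        filter_upwards [this] with w hw
        rw [← sub_smul, norm_smul, ← mul_assoc]
        gcongr
        refine (abs_regLog_sub_le hε (sub_ne_zero.2 hw.symm)).trans ?_
        gcongr
        exact le_abs_self _
    _ ≤ _ := by
        rw [integral_const_mul]
        gcongr
        exact hf.integral_kernel_le locallyIntegrable_norm_inv hz

lemma tendstoUniformlyOn_potGrad (hf : IsBoundedOnDisc f c R M) (ρ : ℝ) :
    TendstoUniformlyOn (fun (n : ℕ) z => potGrad (1 / ((n : ℝ) + 1)) f z) (potGrad 0 f) atTop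
      (ball c ρ) := by
  rw [Metric.tendstoUniformlyOn_iff]
  intro δ hδ
  set C := M * ∫ h : ℂ in ball 0 (ρ + R), ‖‖h‖⁻¹ * (√‖h‖)⁻¹‖ with hC
  have hlim : Tendsto (fun n : ℕ => √(1 / ((n : ℝ) + 1)) * C) atTop (𝓝 (√0 * C)) :=
    ((Real.continuous_sqrt.tendsto 0).comp tendsto_one_div_add_atTop_nhds_zero_nat).mul_const C
  rw [Real.sqrt_zero, zero_mul] at hlim
  filter_upwards [hlim.eventually_lt_const hδ] with n hn z hz
  rw [mem_ball_iff_norm] at hz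
  rw [dist_comm, dist_eq_norm]
  exact (hf.norm_potGrad_sub_le (by positivity) (by linarith)).trans_lt hn

lemma continuous_potGrad (hf : IsBoundedOnDisc f c R M) : Continuous (potGrad 0 f) := by
  rw [continuous_iff_continuousAt]
  intro z
  have h := (hf.tendstoUniformlyOn_potGrad (‖z - c‖ + 1)).continuousOn
    (Frequently.of_forall fun n => (hf.continuous_potGrad_reg (by positivity)).continuousOn)
  exact h.continuousAt (isOpen_ball.mem_nhds (by rw [mem_ball_iff_norm]; linarith))

/-- The potential of a bounded function is differentiable, as a locally uniform limit of the
regularized potentials together with their derivatives. -/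
theorem hasFDerivAt_logPotential (hf : IsBoundedOnDisc f c R M) (z : ℂ) :
    HasFDerivAt (logPotential f) (potGrad 0 f z) z := by
  refine hasFDerivAt_of_tendstoUniformlyOn (isOpen_ball (x := c) (ε := ‖z - c‖ + 1))
    (hf.tendstoUniformlyOn_potGrad _)
    (f := fun (n : ℕ) z => ∫ w, regLog (1 / ((n : ℝ) + 1)) (z - w) • f w)
    (fun n x _ => hf.hasFDerivAt_regLog (by positivity) x) (fun x _ => ?_)
    (by rw [mem_ball_iff_norm]; linarith)
  rw [tendsto_iff_norm_sub_tendsto_zero]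
  set C := M * ∫ h : ℂ in ball 0 (‖x - c‖ + R + 1), ‖‖h‖⁻¹‖ with hC
  have hlim : Tendsto (fun n : ℕ => (1 / ((n : ℝ) + 1)) * C) atTop (𝓝 (0 * C)) :=
    tendsto_one_div_add_atTop_nhds_zero_nat.mul_const C
  rw [zero_mul] at hlim
  refine squeeze_zero (fun n => norm_nonneg _) (fun n => ?_) hlim
  exact hf.norm_regLog_integral_sub_le (by positivity) (by linarith)

theorem contDiff_one_logPotential (hf : IsBoundedOnDisc f c R M) :
    ContDiff ℝ 1 (logPotential f) :=
  contDiff_one_iff_hasFDerivAt.2 ⟨_, hf.continuous_potGrad, hf.hasFDerivAt_logPotential⟩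

end IsBoundedOnDisc

end Potential

/-! ### Second order regularity and the Laplacian of potentials -/

section PotentialRegularity

open MeasureTheory Metric Real

lemma exists_isBoundedOnDisc {E : Type*} [NormedAddCommGroup E] {f : ℂ → E} (hf : Continuous f)
    (hc : HasCompactSupport f) : ∃ R M, IsBoundedOnDisc f 0 R M := by
  obtain ⟨M, hM⟩ := hf.bounded_above_of_compact_support hc
  obtain ⟨R, hR⟩ := hc.isCompact.isBounded.subset_closedBall 0
  exact ⟨R, M, hf.aestronglyMeasurable, hM, fun w hw => image_eq_zero_of_notMem_tsupport
    fun h => hw (hR h)⟩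

lemma logPotential_eq_integral_sub {E : Type*} [NormedAddCommGroup E] [NormedSpace ℝ E]
    (f : ℂ → E) (z : ℂ) : logPotential f z = ∫ t, Real.log ‖t‖ • f (z - t) := by
  rw [logPotential, ← integral_sub_left_eq_self (fun t => Real.log ‖t‖ • f (z - t)) volume z]
  simp

lemma hasFDerivAt_logPotential_of_contDiff {f : ℂ → ℝ} (hf : ContDiff ℝ 1 f)
    (hc : HasCompactSupport f) (z : ℂ) :
    HasFDerivAt (logPotential f) (logPotential (fderiv ℝ f) z) z := by
  have h := hc.hasFDerivAt_convolution_right (ContinuousLinearMap.lsmul ℝ ℝ)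
    locallyIntegrable_log_norm hf z
  have e1 : (convolution (fun h : ℂ => Real.log ‖h‖) f (ContinuousLinearMap.lsmul ℝ ℝ) volume)
      = logPotential f := by
    ext z
    rw [logPotential_eq_integral_sub]
    rfl
  have e2 : (convolution (fun h : ℂ => Real.log ‖h‖) (fderiv ℝ f)
      ((ContinuousLinearMap.lsmul ℝ ℝ).precompR ℂ) volume) z = logPotential (fderiv ℝ f) z := by
    rw [logPotential_eq_integral_sub, convolution_def]
    congr 1
  rwa [e1, e2] at h

/-- The potential of a compactly supported `C¹` function is `C²`: its derivative is the potential
of the derivative. -/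
theorem contDiff_two_logPotential {f : ℂ → ℝ} (hf : ContDiff ℝ 1 f) (hc : HasCompactSupport f) :
    ContDiff ℝ 2 (logPotential f) := by
  have h := hasFDerivAt_logPotential_of_contDiff hf hc
  rw [show (2 : WithTop ℕ∞) = 1 + 1 by norm_num, contDiff_succ_iff_fderiv]
  refine ⟨fun z => (h z).differentiableAt, by simp, ?_⟩
  rw [show fderiv ℝ (logPotential f) = logPotential (fderiv ℝ f) from
    funext fun z => (h z).fderiv]
  obtain ⟨R, M, hb⟩ := exists_isBoundedOnDisc (hf.continuous_fderiv (by norm_num)) (hc.fderiv ℝ)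
  exact hb.contDiff_one_logPotential

/-- The constant `4 ∫ log⁺ (1 / ‖y‖) dy` relating a function to the Laplacian of its logarithmic
potential. (Its value `2π` plays no role; only its positivity matters.) -/
noncomputable def logMass : ℝ := 4 * ∫ y : ℂ, log⁺ ‖y‖⁻¹

lemma integrable_posLog_norm_inv : Integrable (fun y : ℂ => log⁺ ‖y‖⁻¹) := by
  have h1 : IntegrableOn (fun y : ℂ => ‖Real.log ‖y‖‖) (closedBall 0 1) :=
    (locallyIntegrable_log_norm.integrableOn_isCompact (isCompact_closedBall 0 1)).norm
  rw [← integrable_indicator_iff measurableSet_closedBall] at h1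
  refine h1.mono' (Measurable.aestronglyMeasurable (by unfold posLog; fun_prop))
    (Eventually.of_forall fun y => ?_)
  rw [Real.norm_of_nonneg posLog_nonneg]
  by_cases hy : y ∈ closedBall (0 : ℂ) 1
  · rw [indicator_of_mem hy, posLog, Real.log_inv]
    exact max_le (norm_nonneg _) (neg_le_abs _)
  · rw [indicator_of_notMem hy]
    rw [mem_closedBall_zero_iff, not_le] at hy
    apply le_of_eq
    rw [posLog_eq_zero_iff, abs_inv, abs_norm]
    exact inv_le_one_of_one_le₀ hy.le

lemma logMass_pos : 0 < logMass := by
  refine mul_pos (by norm_num) ?_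
  rw [integral_pos_iff_support_of_nonneg (fun y => posLog_nonneg) integrable_posLog_norm_inv]
  have : ball (0 : ℂ) 1 \ {0} ⊆ Function.support (fun y : ℂ => log⁺ ‖y‖⁻¹) := by
    intro y hy
    have h0 : 0 < ‖y‖ := norm_pos_iff.2 hy.2
    have h1 : ‖y‖ < 1 := mem_ball_zero_iff.1 hy.1
    rw [Function.mem_support, Ne, posLog_eq_zero_iff, abs_inv, abs_norm, not_le]
    exact (one_lt_inv₀ h0).2 h1
  refine lt_of_lt_of_le ?_ (measure_mono this)
  rw [measure_sdiff_null (by simp)]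
  exact measure_ball_pos volume _ one_pos

variable {f : ℂ → ℝ} {c z : ℂ} {R M : ℝ}

/-- Fubini's theorem applies to circle averages of the potential. -/
lemma IsBoundedOnDisc.integrable_prod_log (hf : IsBoundedOnDisc f c R M) (z : ℂ) {r : ℝ}
    (hr : 0 < r) :
    Integrable (Function.uncurry fun (θ : ℝ) (w : ℂ) => Real.log ‖circleMap z r θ - w‖ • f w)
      ((volume.restrict (uIoc 0 (2 * π))).prod volume) := by
  have hc : Continuous fun p : ℝ × ℂ => ‖circleMap z r p.1 - p.2‖ := by fun_prop
  have hm : AEStronglyMeasurable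
      (Function.uncurry fun (θ : ℝ) (w : ℂ) => Real.log ‖circleMap z r θ - w‖ • f w)
      ((volume.restrict (uIoc 0 (2 * π))).prod volume) :=
    (Real.measurable_log.comp hc.measurable).aestronglyMeasurable.smul
      (hf.aestronglyMeasurable.comp_snd (μ := volume.restrict (uIoc 0 (2 * π))))
  have hfin : IsFiniteMeasure (volume.restrict (uIoc 0 (2 * π))) :=
    ⟨by simp [uIoc]⟩
  have hint : ∀ θ : ℝ, Integrable (fun w => Real.log ‖circleMap z r θ - w‖ • f w) :=
    fun θ => hf.integrable_log _
  have hbd : ∀ θ : ℝ, ∫ w, ‖Real.log ‖circleMap z r θ - w‖ • f w‖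
      ≤ M * ∫ h : ℂ in ball 0 (r + ‖z - c‖ + R + 1), ‖Real.log ‖h‖‖ := by
    intro θ
    refine le_trans (le_of_eq ?_) (hf.integral_kernel_le locallyIntegrable_log_norm
      (z := circleMap z r θ) ?_)
    · simp only [norm_smul]
    · have : ‖circleMap z r θ - c‖ ≤ r + ‖z - c‖ := by
        calc ‖circleMap z r θ - c‖ = ‖(circleMap z r θ - z) + (z - c)‖ := by congr 1; ring
          _ ≤ _ := norm_add_le _ _
          _ = _ := by simp [circleMap, abs_of_pos hr]
      linarith
  generalize (M * ∫ h : ℂ in ball 0 (r + ‖z - c‖ + R + 1), ‖Real.log ‖h‖‖) = C at hbd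
  set F : ℝ → ℂ → ℝ := fun θ w => Real.log ‖circleMap z r θ - w‖ • f w with hF
  clear_value F
  have h3 : ∀ θ, ∫ w, ‖F θ w‖ ≤ C := fun θ => by
    have := hbd θ
    have e : ∀ w, F θ w = Real.log ‖circleMap z r θ - w‖ • f w := fun w => by rw [hF]
    simpa only [e] using this
  rw [integrable_prod_iff hm]
  refine ⟨Eventually.of_forall fun θ => ?_, ?_⟩
  · have e : (fun w => F θ w) = fun w => Real.log ‖circleMap z r θ - w‖ • f w := by rw [hF]
    simp only [Function.uncurry_apply_pair, e]
    exact hint θ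
  · refine (integrable_const C).mono' hm.norm.integral_prod_right'
      (Eventually.of_forall fun θ => ?_)
    rw [Real.norm_of_nonneg (integral_nonneg fun _ => norm_nonneg _)]
    exact h3 θ

/-- The circle average of `log ‖· - w‖` is explicit, hence so is that of the potential. -/
lemma IsBoundedOnDisc.circleAverage_logPotential (hf : IsBoundedOnDisc f c R M) (z : ℂ) {r : ℝ}
    (hr : 0 < r) :
    circleAverage (logPotential f) z r
      = ∫ w, (Real.log r + log⁺ (r⁻¹ * ‖z - w‖)) • f w := by
  rw [circleAverage_def]
  simp only [logPotential]
  rw [intervalIntegral_integral_swap (hf.integrable_prod_log z hr), ← integral_smul]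
  congr 1
  ext w
  rw [← circleAverage_log_norm_sub_const_eq_log_radius_add_posLog hr.ne', circleAverage_def]
  simp only [smul_eq_mul, intervalIntegral.integral_mul_const, mul_assoc]

/-- After rescaling, the deviation from the mean value property is an average of `f` near `z`. -/
lemma IsBoundedOnDisc.circleAverage_logPotential_sub (hf : IsBoundedOnDisc f c R M) (z : ℂ) {r : ℝ}
    (hr : 0 < r) :
    circleAverage (logPotential f) z r - logPotential f z
      = r ^ 2 * ∫ y : ℂ, log⁺ ‖y‖⁻¹ * f (z - r • y) := by
  have hk : Continuous fun h : ℂ => Real.log r + log⁺ (r⁻¹ * ‖h‖) :=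
    continuous_const.add (continuous_posLog.comp (by fun_prop))
  have hi : Integrable (fun w => (Real.log r + log⁺ (r⁻¹ * ‖z - w‖)) • f w) := by
    refine (hf.integrable_kernel hk.locallyIntegrable z).mono' ?_
      (Eventually.of_forall fun w => by rw [norm_smul])
    exact AEStronglyMeasurable.smul (hk.comp (by fun_prop)).aestronglyMeasurable
      hf.aestronglyMeasurable
  rw [hf.circleAverage_logPotential z hr, logPotential, ← integral_sub hi (hf.integrable_log z)]
  set F : ℂ → ℝ := fun x => log⁺ ‖r⁻¹ • x‖⁻¹ * f (z - x) with hF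
  have h1 : ∫ y : ℂ, log⁺ ‖y‖⁻¹ * f (z - r • y) = (r ^ 2)⁻¹ * ∫ x, F x := by
    have := Measure.integral_comp_smul volume F r
    rw [Complex.finrank_real_complex, abs_of_pos (by positivity), smul_eq_mul] at this
    rw [← this]
    congr 1
    ext y
    simp [hF, hr.ne']
  rw [h1, ← mul_assoc, mul_inv_cancel₀ (by positivity), one_mul,
    ← integral_sub_left_eq_self F volume z]
  refine integral_congr_ae ?_
  have : ∀ᵐ w : ℂ, w ≠ z := by simp [ae_iff]
  filter_upwards [this] with w hw
  have hw' : ‖z - w‖ ≠ 0 := norm_ne_zero_iff.2 (sub_ne_zero.2 hw.symm)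
  have h2 := posLog_sub_posLog_inv (x := r⁻¹ * ‖z - w‖)
  rw [Real.log_mul (by positivity) hw', Real.log_inv] at h2
  simp only [hF, norm_smul, norm_inv, Real.norm_of_nonneg hr.le, smul_eq_mul, sub_sub_cancel]
  rw [← sub_mul]
  congr 1
  linarith

/-- The Laplacian of the logarithmic potential of `f` is a constant multiple of `f`. -/
theorem IsBoundedOnDisc.hasMeanLaplacianAt_logPotential (hf : IsBoundedOnDisc f c R M)
    (hz : ContinuousAt f z) : HasMeanLaplacianAt (logPotential f) (logMass * f z) z := by
  have hlim : Tendsto (fun r : ℝ => ∫ y : ℂ, log⁺ ‖y‖⁻¹ * f (z - r • y)) (𝓝[>] 0)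
      (𝓝 (∫ y : ℂ, log⁺ ‖y‖⁻¹ * f z)) := by
    refine tendsto_integral_filter_of_dominated_convergence (fun y => log⁺ ‖y‖⁻¹ * M) ?_ ?_
      (integrable_posLog_norm_inv.mul_const M) ?_
    · filter_upwards [self_mem_nhdsWithin] with r hr
      exact integrable_posLog_norm_inv.aestronglyMeasurable.mul
        ((hf.integrable.comp_sub_left z).comp_smul (ne_of_gt hr)).aestronglyMeasurable
    · refine Eventually.of_forall fun r => Eventually.of_forall fun y => ?_
      rw [norm_mul, Real.norm_of_nonneg posLog_nonneg]
      gcongr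
      · exact posLog_nonneg
      · exact hf.norm_le _
    · refine Eventually.of_forall fun y => ?_
      refine Tendsto.const_mul _ (hz.tendsto.comp ?_)
      have : Continuous fun r : ℝ => z - r • y := by fun_prop
      have h := this.tendsto 0
      simp only [zero_smul, sub_zero] at h
      exact h.mono_left nhdsWithin_le_nhds
  rw [integral_mul_const] at hlim
  have := hlim.const_mul 4
  rw [← mul_assoc] at this
  refine Tendsto.congr' ?_ this
  filter_upwards [self_mem_nhdsWithin] with r hr
  have hr' : 0 < r := hr
  rw [hf.circleAverage_logPotential_sub z hr']
  field_simp

end PotentialRegularity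

/-! ### The Dirichlet problem for Liouville's equation -/

section Dirichlet

open MeasureTheory Metric InnerProductSpace

variable {c z : ℂ} {R M B : ℝ}

/-- On small discs the logarithmic potential is small; this makes the map below a contraction. -/
lemma exists_radius_integral_log_lt {η : ℝ} (hη : 0 < η) :
    ∃ R₀ > 0, ∀ R, 0 < R → R ≤ R₀ → ∫ h : ℂ in ball 0 (3 * R), ‖Real.log ‖h‖‖ < η := by
  set g : ℂ → ℝ := (ball (0 : ℂ) 3).indicator fun h => ‖Real.log ‖h‖‖ with hg
  have hgi : Integrable g := by
    rw [hg, integrable_indicator_iff measurableSet_ball]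
    exact ((locallyIntegrable_log_norm.integrableOn_isCompact
      (isCompact_closedBall 0 3)).mono_set ball_subset_closedBall).norm
  have hs : Tendsto (volume ∘ fun R : ℝ => ball (0 : ℂ) (3 * R)) (𝓝[>] 0) (𝓝 0) := by
    have h1 : Continuous fun R : ℝ => ENNReal.ofReal (3 * R) ^ 2 * (NNReal.pi : ENNReal) := by
      refine ENNReal.continuous_mul_const (by simp) |>.comp ?_
      exact (ENNReal.continuous_pow 2).comp (ENNReal.continuous_ofReal.comp (by fun_prop))
    have h2 := h1.tendsto 0
    simp only [mul_zero, ENNReal.ofReal_zero, ne_eq, OfNat.ofNat_ne_zero, not_false_eq_true,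
      zero_pow, zero_mul] at h2
    refine Tendsto.congr (fun R => ?_) (h2.mono_left nhdsWithin_le_nhds)
    simp [Complex.volume_ball]
  have h := hgi.tendsto_setIntegral_nhds_zero hs
  obtain ⟨δ, hδ, H⟩ := mem_nhdsGT_iff_exists_Ioo_subset.1 (h.eventually_lt_const hη)
  have hδ' : 0 < δ := hδ
  refine ⟨min (δ / 2) 1, by positivity, fun R hR hR' => ?_⟩
  have hm : R ∈ Ioo 0 δ := ⟨hR, by linarith [hR'.trans (min_le_left _ _)]⟩
  have h3 := H hm
  have hR1 := hR'.trans (min_le_right _ _)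
  refine lt_of_le_of_lt (le_of_eq ?_) h3
  refine setIntegral_congr_fun measurableSet_ball fun h hh => ?_
  rw [mem_ball_zero_iff] at hh
  rw [hg, indicator_of_mem]
  rw [mem_ball_zero_iff]
  linarith

lemma IsBoundedOnDisc.norm_logPotential_le_of_mem {E : Type*} [NormedAddCommGroup E]
    [NormedSpace ℝ E] {f : ℂ → E} (hf : IsBoundedOnDisc f c R M) (hR : 0 < R)
    (hz : z ∈ closedBall c R) :
    ‖logPotential f z‖ ≤ M * ∫ h : ℂ in ball 0 (3 * R), ‖Real.log ‖h‖‖ := by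
  rw [mem_closedBall_iff_norm] at hz
  exact hf.norm_logPotential_le (by linarith)

lemma abs_exp_sub_exp_le {x y b : ℝ} (hx : x ≤ b) (hy : y ≤ b) :
    |Real.exp x - Real.exp y| ≤ Real.exp b * |x - y| := by
  wlog h : y ≤ x generalizing x y
  · rw [abs_sub_comm, abs_sub_comm x]
    exact this hy hx (le_of_not_ge h)
  rw [abs_of_nonneg (sub_nonneg.2 (Real.exp_le_exp.2 h)), abs_of_nonneg (sub_nonneg.2 h)]
  have h1 := Real.add_one_le_exp (y - x)
  have h2 : Real.exp y = Real.exp x * Real.exp (y - x) := by rw [← Real.exp_add]; ring_nf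
  have h3 : Real.exp x ≤ Real.exp b := Real.exp_le_exp.2 hx
  calc Real.exp x - Real.exp y = Real.exp x * (1 - Real.exp (y - x)) := by rw [h2]; ring
    _ ≤ Real.exp x * (x - y) :=
        mul_le_mul_of_nonneg_left (by linarith) (Real.exp_pos x).le
    _ ≤ Real.exp b * (x - y) := mul_le_mul_of_nonneg_right h3 (sub_nonneg.2 h)

/-- The density `exp (2 min (v, B))` on the closed disc, extended by zero. -/
noncomputable def truncDensity (c : ℂ) (R B : ℝ) (v : ℂ → ℝ) : ℂ → ℝ :=
  (closedBall c R).indicator fun w => Real.exp (2 * min (v w) B)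

lemma isBoundedOnDisc_indicator {g : ℂ → ℝ} (hg : ContinuousOn g (closedBall c R)) (hM : 0 ≤ M)
    (hb : ∀ w ∈ closedBall c R, ‖g w‖ ≤ M) :
    IsBoundedOnDisc ((closedBall c R).indicator g) c R M := by
  refine ⟨?_, fun w => ?_, fun w hw => indicator_of_notMem hw _⟩
  · exact (aestronglyMeasurable_indicator_iff measurableSet_closedBall).2
      (hg.aestronglyMeasurable measurableSet_closedBall)
  · by_cases hw : w ∈ closedBall c R
    · rw [indicator_of_mem hw]; exact hb w hw
    · rw [indicator_of_notMem hw]; simpa using hM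

lemma isBoundedOnDisc_truncDensity {v : ℂ → ℝ} (hv : ContinuousOn v (closedBall c R)) :
    IsBoundedOnDisc (truncDensity c R B v) c R (Real.exp (2 * B)) := by
  refine isBoundedOnDisc_indicator (by fun_prop) (by positivity) fun w _ => ?_
  rw [Real.norm_of_nonneg (by positivity)]
  gcongr
  exact min_le_right _ _

lemma isBoundedOnDisc_truncDensity_sub {v w : ℂ → ℝ} (hv : ContinuousOn v (closedBall c R))
    (hw : ContinuousOn w (closedBall c R)) {d : ℝ} (hd : 0 ≤ d)
    (h : ∀ x ∈ closedBall c R, |v x - w x| ≤ d) :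
    IsBoundedOnDisc (fun x => truncDensity c R B v x - truncDensity c R B w x) c R
      (Real.exp (2 * B) * (2 * d)) := by
  have e : (fun x => truncDensity c R B v x - truncDensity c R B w x)
      = (closedBall c R).indicator
        (fun x => Real.exp (2 * min (v x) B) - Real.exp (2 * min (w x) B)) := by
    ext x
    by_cases hx : x ∈ closedBall c R <;> simp [truncDensity, hx]
  rw [e]
  refine isBoundedOnDisc_indicator (by fun_prop) (by positivity) fun x hx => ?_
  refine (abs_exp_sub_exp_le (b := 2 * B) ?_ ?_).trans ?_
  · gcongr; exact min_le_right _ _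
  · gcongr; exact min_le_right _ _
  · gcongr
    rw [← mul_sub, abs_mul, abs_two]
    gcongr
    have := abs_min_sub_min_le_max (v x) B (w x) B
    simp only [sub_self, abs_zero] at this
    exact this.trans (max_le (h x hx) hd)

/-- The normalized potential, whose Laplacian is `f`. -/
noncomputable def normPotential (f : ℂ → ℝ) (z : ℂ) : ℝ := logMass⁻¹ * logPotential f z

lemma IsBoundedOnDisc.abs_normPotential_le {f : ℂ → ℝ} (hf : IsBoundedOnDisc f c R M) (hR : 0 < R)
    (hz : z ∈ closedBall c R) :
    |normPotential f z| ≤ logMass⁻¹ * (M * ∫ h : ℂ in ball 0 (3 * R), ‖Real.log ‖h‖‖) := by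
  have h0 := inv_pos.2 logMass_pos
  rw [normPotential, abs_mul, abs_of_pos h0]
  gcongr
  exact hf.norm_logPotential_le_of_mem hR hz

lemma IsBoundedOnDisc.contDiff_normPotential {f : ℂ → ℝ} (hf : IsBoundedOnDisc f c R M) :
    ContDiff ℝ 1 (normPotential f) :=
  contDiff_const.mul hf.contDiff_one_logPotential

lemma IsBoundedOnDisc.hasMeanLaplacianAt_normPotential {f : ℂ → ℝ}
    (hf : IsBoundedOnDisc f c R M) (hz : ContinuousAt f z) :
    HasMeanLaplacianAt (normPotential f) (f z) z := by
  have := (hf.hasMeanLaplacianAt_logPotential hz).const_mul logMass⁻¹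
  rwa [← mul_assoc, inv_mul_cancel₀ logMass_pos.ne', one_mul] at this

lemma normPotential_sub {f g : ℂ → ℝ} {M' : ℝ} (hf : IsBoundedOnDisc f c R M)
    (hg : IsBoundedOnDisc g c R M') :
    normPotential (fun w => f w - g w) z = normPotential f z - normPotential g z := by
  rw [normPotential, normPotential, normPotential, ← mul_sub, logPotential, logPotential,
    logPotential, ← integral_sub (hf.integrable_log z) (hg.integrable_log z)]
  simp only [smul_sub]

/-- The solution on the disc of `Δu = f` with boundary values `φ`. -/
noncomputable def poissonSolution (φ f : ℂ → ℝ) (c : ℂ) (R : ℝ) (z : ℂ) : ℝ :=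
  poissonExt (fun w => φ w - normPotential f w) c R z + normPotential f z

lemma continuousOn_poissonSolution {φ f : ℂ → ℝ} (hφ : ContinuousOn φ (sphere c R))
    (hf : IsBoundedOnDisc f c R M) : ContinuousOn (poissonSolution φ f c R) (closedBall c R) := by
  have h1 : Continuous (normPotential f) := hf.contDiff_normPotential.continuous
  exact (continuousOn_poissonExt (hφ.sub h1.continuousOn)).add h1.continuousOn

lemma abs_poissonSolution_sub_le {φ f g : ℂ → ℝ} {M' d : ℝ} (hR : 0 < R)
    (hφ : ContinuousOn φ (sphere c R)) (hf : IsBoundedOnDisc f c R M)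
    (hg : IsBoundedOnDisc g c R M') (hfg : IsBoundedOnDisc (fun w => f w - g w) c R d)
    (hz : z ∈ closedBall c R) :
    |poissonSolution φ f c R z - poissonSolution φ g c R z|
      ≤ 2 * (logMass⁻¹ * (d * ∫ h : ℂ in ball 0 (3 * R), ‖Real.log ‖h‖‖)) := by
  have cf : Continuous (normPotential f) := hf.contDiff_normPotential.continuous
  have cg : Continuous (normPotential g) := hg.contDiff_normPotential.continuous
  have h1 : poissonSolution φ f c R z - poissonSolution φ g c R z
      = poissonExt (fun w => normPotential g w - normPotential f w) c R z
        + normPotential (fun w => f w - g w) z := by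
    have e := poissonExt_sub (φ := fun w => φ w - normPotential f w)
      (ψ := fun w => φ w - normPotential g w) (z := z)
      (hφ.sub cf.continuousOn) (hφ.sub cg.continuousOn)
    simp only [sub_sub_sub_cancel_left] at e
    rw [normPotential_sub hf hg, poissonSolution, poissonSolution, e]
    ring
  rw [h1, two_mul]
  refine (abs_add_le _ _).trans (add_le_add ?_ (hfg.abs_normPotential_le hR hz))
  refine abs_poissonExt_le (cg.sub cf).continuousOn (fun w hw => ?_) hz
  rw [abs_sub_comm, ← normPotential_sub hf hg]
  exact hfg.abs_normPotential_le hR (sphere_subset_closedBall hw)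

/-- On a small disc, the Dirichlet problem for `ΔV = exp (2V)` is solved by the contraction
principle for the map `v ↦ poissonSolution φ (exp (2 min (v, B)))`. -/
lemma exists_eq_poissonSolution {φ : ℂ → ℝ} (hR : 0 < R)
    (hA : 2 * (logMass⁻¹ * (Real.exp (2 * B) * 2 * ∫ h : ℂ in ball 0 (3 * R), ‖Real.log ‖h‖‖))
      ≤ 1 / 2)
    (hφ : ContinuousOn φ (sphere c R)) (hφB : ∀ w ∈ sphere c R, φ w ≤ B - 1) :
    ∃ V : ℂ → ℝ, ContinuousOn V (closedBall c R) ∧ (∀ z ∈ closedBall c R, V z ≤ B) ∧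
      ∀ z ∈ closedBall c R, V z = poissonSolution φ (truncDensity c R B V) c R z := by
  set ext : C(closedBall c R, ℝ) → ℂ → ℝ := fun v => Function.extend Subtype.val v 0 with hext
  have ext_apply : ∀ v (x : closedBall c R), ext v x = v x := fun v x =>
    Subtype.val_injective.extend_apply _ _ _
  have ext_cont : ∀ v, ContinuousOn (ext v) (closedBall c R) := fun v => by
    rw [continuousOn_iff_continuous_domRestrict]
    have : (closedBall c R).domRestrict (ext v) = v := by
      ext x
      exact ext_apply v x
    rw [this]
    exact v.continuous
  have hb : ∀ v, IsBoundedOnDisc (truncDensity c R B (ext v)) c R (Real.exp (2 * B)) :=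
    fun v => isBoundedOnDisc_truncDensity (ext_cont v)
  set T : C(closedBall c R, ℝ) → C(closedBall c R, ℝ) := fun v =>
    ⟨(closedBall c R).domRestrict (poissonSolution φ (truncDensity c R B (ext v)) c R),
      continuousOn_iff_continuous_domRestrict.1 (continuousOn_poissonSolution hφ (hb v))⟩ with hT
  have hcontr : ContractingWith (1 / 2) T := by
    refine ⟨by rw [← NNReal.coe_lt_coe]; norm_num, LipschitzWith.of_dist_le_mul fun v w => ?_⟩
    rw [ContinuousMap.dist_le (by positivity)]
    intro x
    have hd : ∀ y ∈ closedBall c R, |ext v y - ext w y| ≤ dist v w := fun y hy => by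
      have h1 := ext_apply v ⟨y, hy⟩
      have h2 := ext_apply w ⟨y, hy⟩
      simp only at h1 h2
      rw [h1, h2, ← Real.dist_eq]
      exact ContinuousMap.dist_apply_le_dist _
    have h := abs_poissonSolution_sub_le hR hφ (hb v) (hb w)
      (isBoundedOnDisc_truncDensity_sub (ext_cont v) (ext_cont w) dist_nonneg hd) x.2
    rw [Real.dist_eq]
    refine h.trans ?_
    have h2 := mul_le_mul_of_nonneg_right hA (dist_nonneg (x := v) (y := w))
    refine le_trans (le_of_eq ?_) (h2.trans (le_of_eq ?_))
    · ring
    · simp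
  have hfix := hcontr.fixedPoint_isFixedPt
  set v := ContractingWith.fixedPoint T hcontr with hv
  have heq : ∀ z ∈ closedBall c R,
      ext v z = poissonSolution φ (truncDensity c R B (ext v)) c R z := by
    intro z hz
    have h1 := ext_apply v ⟨z, hz⟩
    simp only at h1
    rw [h1]
    have h2 := congrArg (fun g : C(closedBall c R, ℝ) => g ⟨z, hz⟩) hfix
    exact h2.symm
  refine ⟨ext v, ext_cont v, fun z hz => ?_, heq⟩
  rw [heq z hz, poissonSolution]
  have hq : ∀ x ∈ closedBall c R, |normPotential (truncDensity c R B (ext v)) x| ≤ 1 / 8 := by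
    intro x hx
    refine ((hb v).abs_normPotential_le hR hx).trans ?_
    nlinarith
  have h1 := (abs_le.1 (hq z hz)).2
  have h2 : poissonExt (fun w => φ w - normPotential (truncDensity c R B (ext v)) w) c R z
      ≤ B - 1 + 1 / 8 := by
    refine poissonExt_le
      (hφ.sub (hb v).contDiff_normPotential.continuous.continuousOn) (fun w hw => ?_) hz
    have h3 := (abs_le.1 (hq w (sphere_subset_closedBall hw))).1
    have h4 := hφB w hw
    linarith
  linarith

/-- Bootstrapping: a `C¹` function with generalized Laplacian `exp (2V)` is `C²`, since it differs
locally from the potential of a compactly supported `C¹` function by a harmonic function. -/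
theorem contDiffAt_two_of_hasMeanLaplacianAt {V : ℂ → ℝ} {U : Set ℂ} (hU : IsOpen U)
    (hV : ContDiffOn ℝ 1 V U) (hL : ∀ z ∈ U, HasMeanLaplacianAt V (Real.exp (2 * V z)) z)
    {a : ℂ} (ha : a ∈ U) : ContDiffAt ℝ 2 V a := by
  obtain ⟨δ, hδ, hδU⟩ := Metric.isOpen_iff.1 hU a ha
  let χ : ContDiffBump a := ⟨δ / 3, δ / 2, by positivity, by linarith⟩
  set g : ℂ → ℝ := fun w => χ w * Real.exp (2 * V w) with hg
  have hgc : HasCompactSupport g := χ.hasCompactSupport.mul_right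
  have hVat : ∀ w ∈ U, ContDiffAt ℝ 1 V w := fun w hw => (hV w hw).contDiffAt (hU.mem_nhds hw)
  have hgd : ContDiff ℝ 1 g := by
    rw [contDiff_iff_contDiffAt]
    intro w
    by_cases hw : w ∈ ball a δ
    · exact χ.contDiff.contDiffAt.mul
        ((contDiffAt_const.mul (hVat w (hδU hw))).exp)
    · have hz : g =ᶠ[𝓝 w] fun _ => 0 := by
        have hnot : w ∉ tsupport χ := by
          rw [χ.tsupport_eq]
          intro h
          rw [mem_closedBall] at h
          rw [mem_ball, not_lt] at hw
          have : χ.rOut = δ / 2 := rfl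
          linarith
        filter_upwards [(isClosed_tsupport χ).isOpen_compl.mem_nhds hnot] with x hx
        simp [hg, image_eq_zero_of_notMem_tsupport hx]
      exact contDiffAt_const.congr_of_eventuallyEq hz
  obtain ⟨R', M', hb⟩ := exists_isBoundedOnDisc hgd.continuous hgc
  have hW2 : ContDiff ℝ 2 (normPotential g) :=
    contDiff_const.mul (contDiff_two_logPotential hgd hgc)
  have hsub : closedBall a (δ / 3) ⊆ U := (closedBall_subset_ball (by linarith)).trans hδU
  have hVc : ContinuousOn V (closedBall a (δ / 3)) := fun w hw =>
    (hVat w (hsub hw)).continuousAt.continuousWithinAt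
  set u : ℂ → ℝ := fun w => V w + (-1) * normPotential g w with hu
  have huc : ContinuousOn u (closedBall a (δ / 3)) :=
    hVc.add (continuous_const.mul hW2.continuous).continuousOn
  have huL : ∀ z ∈ ball a (δ / 3), HasMeanLaplacianAt u 0 z := by
    intro z hz
    have h1 := hL z (hsub (ball_subset_closedBall hz))
    have h2 := (hb.hasMeanLaplacianAt_normPotential hgd.continuous.continuousAt (z := z)).const_mul
      (-1)
    have h3 := h1.add h2 (eventually_continuousAt_of_mem_ball hVc hz)
      (Eventually.of_forall fun w => (continuous_const.mul hW2.continuous).continuousAt)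
    have h4 : g z = Real.exp (2 * V z) := by
      have : χ z = 1 := χ.one_of_mem_closedBall (ball_subset_closedBall hz)
      simp [hg, this]
    rw [h4] at h3
    convert h3 using 1
    ring
  have ha' : a ∈ ball a (δ / 3) := mem_ball_self (by positivity)
  have hP := (harmonicAt_poissonExt (huc.mono sphere_subset_closedBall) ha').1.add
    hW2.contDiffAt
  refine hP.congr_of_eventuallyEq ?_
  filter_upwards [isOpen_ball.mem_nhds ha'] with w hw
  have := eq_poissonExt_of_hasMeanLaplacianAt_zero (by positivity) huc huL
    (ball_subset_closedBall hw)
  rw [← this, hu]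
  ring

/-- `V` is a solution of Liouville's equation `ΔV = exp (2V)` on the open disc which is continuous
on the closed disc; equivalently `exp V` is a density of constant curvature `-1`. -/
structure IsLiouvilleSolution (V : ℂ → ℝ) (c : ℂ) (R : ℝ) : Prop where
  continuousOn : ContinuousOn V (closedBall c R)
  contDiffAt : ∀ z ∈ ball c R, ContDiffAt ℝ 2 V z
  hasMeanLaplacianAt : ∀ z ∈ ball c R, HasMeanLaplacianAt V (Real.exp (2 * V z)) z

lemma abs_normPotential_sub_le {f : ℂ → ℝ} (hf : IsBoundedOnDisc f c R M) (hR : 0 < R)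
    (hz : z ∈ closedBall c R) :
    |normPotential f z - normPotential f c|
      ≤ logMass⁻¹ * (M * ∫ h : ℂ in ball 0 (3 * R), ‖‖h‖⁻¹‖) * ‖z - c‖ := by
  have h0 := inv_pos.2 logMass_pos
  rw [normPotential, normPotential, ← mul_sub, abs_mul, abs_of_pos h0, mul_assoc]
  gcongr
  refine Convex.norm_image_sub_le_of_norm_hasFDerivWithin_le (s := closedBall c R)
    (fun x _ => (hf.hasFDerivAt_logPotential x).hasFDerivWithinAt) (fun x hx => ?_)
    (convex_closedBall c R) (mem_closedBall_self hR.le) hz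
  rw [mem_closedBall_iff_norm] at hx
  exact hf.norm_potGrad_le (by linarith)

/-- Solvability of the Dirichlet problem for Liouville's equation on small discs, together with a
Lipschitz bound at the centre which depends only on bounds for the boundary values. -/
theorem exists_liouvilleSolution (M : ℝ) : ∃ R₀ > 0, ∀ R, 0 < R → R ≤ R₀ → ∀ m : ℝ, ∃ L : ℝ,
    ∀ (c : ℂ) (φ : ℂ → ℝ), ContinuousOn φ (sphere c R) → (∀ w ∈ sphere c R, φ w ≤ M) →
      ∃ V, IsLiouvilleSolution V c R ∧ (∀ w ∈ sphere c R, V w = φ w) ∧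
        ((∀ w ∈ sphere c R, m ≤ φ w) →
          ∀ z ∈ closedBall c (R / 2), |V z - V c| ≤ L * ‖z - c‖) := by
  have h0 := inv_pos.2 logMass_pos
  -- the contraction takes place below the level `B`: the potential changes the boundary bound `M` by
  -- less than `1`, so that the truncation at `B` is not active at the fixed point
  set B := M + 1 with hB
  set C := 2 * (logMass⁻¹ * (Real.exp (2 * B) * 2)) with hC
  have hC0 : 0 < C := by positivity
  obtain ⟨R₀, hR₀, H⟩ := exists_radius_integral_log_lt (show 0 < 1 / (2 * C) by positivity)
  refine ⟨R₀, hR₀, fun R hR hRR m => ?_⟩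
  have hA := H R hR hRR
  rw [lt_div_iff₀ (by positivity)] at hA
  set A := ∫ h : ℂ in ball 0 (3 * R), ‖Real.log ‖h‖‖ with hAdef
  set Q := logMass⁻¹ * (Real.exp (2 * B) * A) with hQ
  set D := logMass⁻¹ * (Real.exp (2 * B) * ∫ h : ℂ in ball 0 (3 * R), ‖‖h‖⁻¹‖) with hD
  refine ⟨4 / R * (max |m| |M| + Q) + D, fun c φ hφ hφM => ?_⟩
  obtain ⟨V, hVc, hVB, hV⟩ := exists_eq_poissonSolution (B := B) hR
    (by rw [← hAdef]; rw [hC] at hA; linarith) hφ (fun w hw => by simpa [hB] using hφM w hw)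
  set f := truncDensity c R B V with hf
  have hfb : IsBoundedOnDisc f c R (Real.exp (2 * B)) := isBoundedOnDisc_truncDensity hVc
  have hq := hfb.contDiff_normPotential
  have hψ : ContinuousOn (fun w => φ w - normPotential f w) (sphere c R) :=
    hφ.sub hq.continuous.continuousOn
  have hfz : ∀ z ∈ closedBall c R, f z = Real.exp (2 * V z) := fun z hz => by
    rw [hf, truncDensity, indicator_of_mem hz, min_eq_left (hVB z hz)]
  have hVat : ∀ z ∈ ball c R, ∀ᶠ w in 𝓝 z,
      poissonExt (fun w => φ w - normPotential f w) c R w + normPotential f w = V w := by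
    intro z hz
    filter_upwards [isOpen_ball.mem_nhds hz] with w hw
    exact (hV w (ball_subset_closedBall hw)).symm
  have hL : ∀ z ∈ ball c R, HasMeanLaplacianAt V (Real.exp (2 * V z)) z := by
    intro z hz
    have hfc : ContinuousAt f z := by
      have h1 : ContinuousAt (fun w => Real.exp (2 * V w)) z := by
        have := hVc.continuousAt (mem_of_superset (isOpen_ball.mem_nhds hz) ball_subset_closedBall)
        fun_prop
      refine h1.congr ?_
      filter_upwards [isOpen_ball.mem_nhds hz] with w hw
      exact (hfz w (ball_subset_closedBall hw)).symm
    have h1 := (harmonicAt_poissonExt hψ hz).hasMeanLaplacianAt.add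
      (hfb.hasMeanLaplacianAt_normPotential hfc)
      (eventually_continuousAt_of_mem_ball (continuousOn_poissonExt hψ) hz)
      (Eventually.of_forall fun w => hq.continuous.continuousAt)
    rw [zero_add, hfz z (ball_subset_closedBall hz)] at h1
    exact h1.congr (hVat z hz)
  have hC1 : ContDiffOn ℝ 1 V (ball c R) := by
    intro z hz
    have h1 := ((harmonicAt_poissonExt hψ hz).1.of_le (m := 1) (by norm_num)).add hq.contDiffAt
    refine (h1.congr_of_eventuallyEq ?_).contDiffWithinAt
    filter_upwards [hVat z hz] with w hw using hw.symm
  refine ⟨V, ⟨hVc, fun z hz => contDiffAt_two_of_hasMeanLaplacianAt isOpen_ball hC1 hL hz, hL⟩,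
    fun w hw => ?_, fun hm z hz => ?_⟩
  · rw [hV w (sphere_subset_closedBall hw), poissonSolution, poissonExt_sphere hw]
    ring
  · have hz' : ‖z - c‖ ≤ R / 2 := mem_closedBall_iff_norm.1 hz
    have hzc : z ∈ closedBall c R := closedBall_subset_closedBall (by linarith) hz
    rw [hV z hzc, hV c (mem_closedBall_self hR.le), poissonSolution, poissonSolution,
      add_sub_add_comm, add_mul]
    refine (abs_add_le _ _).trans (add_le_add ?_ (abs_normPotential_sub_le hfb hR hzc))
    refine abs_poissonExt_sub_center_le hR hψ (fun w hw => ?_) hz'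
    refine (abs_sub _ _).trans (add_le_add ?_
      (hfb.abs_normPotential_le hR (sphere_subset_closedBall hw)))
    exact abs_le_max_abs_abs (hm w hw) (hφM w hw)

end Dirichlet

/-! ### SK-metrics and Ahlfors' lemma -/

section SK

open Metric

variable {G : Set ℂ} {ρ σ : ℂ → ℝ} {c z : ℂ} {R : ℝ}

lemma lowerCurvature_le_neg_one_iff (h : 0 < ρ z) :
    lowerCurvature ρ z ≤ -1 ↔
      ((ρ z ^ 2 : ℝ) : EReal) ≤ lowerLaplacian (fun w => Real.log (ρ w)) z := by
  have h0 : (0 : EReal) < ((ρ z ^ 2 : ℝ) : EReal) := by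
    exact_mod_cast pow_pos h 2
  rw [lowerCurvature, EReal.div_le_iff_le_mul h0 (EReal.coe_ne_top _), mul_neg, mul_one,
    EReal.neg_le_neg_iff]

lemma IsConformalPseudoMetric.eventually_pos (hG : IsOpen G) (hρ : IsConformalPseudoMetric G ρ)
    (hz : z ∈ G) (h : 0 < ρ z) : ∀ᶠ w in 𝓝 z, w ∈ G ∧ 0 < ρ w :=
  (hG.eventually_mem hz).and
    ((hρ.continuousOn.continuousAt (hG.mem_nhds hz)).eventually_const_lt h)

lemma IsConformalPseudoMetric.eventually_continuousAt_log (hG : IsOpen G)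
    (hρ : IsConformalPseudoMetric G ρ) (hz : z ∈ G) (h : 0 < ρ z) :
    ∀ᶠ w in 𝓝 z, ContinuousAt (fun w => Real.log (ρ w)) w := by
  filter_upwards [hρ.eventually_pos hG hz h] with w hw
  exact (hρ.continuousOn.continuousAt (hG.mem_nhds hw.1)).log hw.2.ne'

lemma IsSKMetric.sq_le_lowerLaplacian (hρ : IsSKMetric G ρ) (hz : z ∈ G) (h : 0 < ρ z) :
    ((ρ z ^ 2 : ℝ) : EReal) ≤ lowerLaplacian (fun w => Real.log (ρ w)) z :=
  (lowerCurvature_le_neg_one_iff h).1 (hρ.curvature_le z hz h)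

/-- The curvature condition at a point is inherited from a smaller SK-metric touching the density
there. -/
lemma IsSKMetric.lowerCurvature_le_of_touching (hG : IsOpen G) (hρ : IsSKMetric G ρ)
    (hσ : IsConformalPseudoMetric G σ) (hz : z ∈ G) (h : 0 < σ z) (he : ρ z = σ z)
    (hle : ∀ᶠ w in 𝓝 z, ρ w ≤ σ w) : lowerCurvature σ z ≤ -1 := by
  rw [lowerCurvature_le_neg_one_iff h, ← he]
  have h' : 0 < ρ z := he ▸ h
  refine (hρ.sq_le_lowerLaplacian hz h').trans (lowerLaplacian_mono ?_ (by rw [he])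
    (hρ.eventually_continuousAt_log hG hz h') (hσ.eventually_continuousAt_log hG hz h))
  filter_upwards [hle, hρ.eventually_pos hG hz h'] with w hw hw'
  exact Real.log_le_log hw'.2 hw

lemma IsSKMetric.max (hG : IsOpen G) (hρ : IsSKMetric G ρ) (hσ : IsSKMetric G σ) :
    IsSKMetric G (fun z => max (ρ z) (σ z)) := by
  have hm : IsConformalPseudoMetric G (fun z => Max.max (ρ z) (σ z)) := by
    refine ⟨hρ.continuousOn.sup hσ.continuousOn, fun z hz => le_max_of_le_left (hρ.nonneg z hz), ?_⟩
    obtain ⟨z, hz, h⟩ := hρ.not_identically_zero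
    refine ⟨z, hz, (lt_of_lt_of_le ?_ (le_max_left _ _)).ne'⟩
    exact lt_of_le_of_ne (hρ.nonneg z hz) h.symm
  refine ⟨hm, fun z hz h => ?_⟩
  rcases le_total (σ z) (ρ z) with hle | hle
  · exact hρ.lowerCurvature_le_of_touching hG hm hz h (max_eq_left hle).symm
      (Eventually.of_forall fun w => le_max_left _ _)
  · exact hσ.lowerCurvature_le_of_touching hG hm hz h (max_eq_right hle).symm
      (Eventually.of_forall fun w => le_max_right _ _)

/-- Ahlfors' lemma: an SK-metric on `G` is dominated on a compact set `K` by the density `1 / g`,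
where `1 / g` has curvature at least `-1` and blows up at the boundary of `K`. -/
theorem IsSKMetric.mul_le_one (hρ : IsSKMetric G ρ) (hG : IsOpen G) {K : Set ℂ} (hK : IsCompact K)
    (hKG : K ⊆ G) {g : ℂ → ℝ} (hg : ContinuousOn g K)
    (H : ∀ z ∈ K, 0 < g z → K ∈ 𝓝 z ∧
      ∃ L ≤ ((g z) ^ 2)⁻¹, HasMeanLaplacianAt (fun w => -Real.log (g w)) L z)
    (hz : z ∈ K) : ρ z * g z ≤ 1 := by
  have hcont : ContinuousOn (fun w => ρ w * g w) K := (hρ.continuousOn.mono hKG).mul hg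
  obtain ⟨x, hx, hmax⟩ := hK.exists_isMaxOn ⟨z, hz⟩ hcont
  refine (hmax hz).trans ?_
  by_contra! hlt
  have hρ0 : 0 ≤ ρ x := hρ.nonneg x (hKG hx)
  have hgx : 0 < g x := pos_of_mul_pos_right (by linarith) hρ0
  have hρx : 0 < ρ x := pos_of_mul_pos_left (by linarith) hgx.le
  obtain ⟨hKx, L, hL, hLap⟩ := H x hx hgx
  have hgev : ∀ᶠ w in 𝓝 x, 0 < g w := (hg.continuousAt hKx).eventually_const_lt hgx
  have hKev : ∀ᶠ w in 𝓝 x, K ∈ 𝓝 w := eventually_mem_nhds_iff.2 hKx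
  have h1 := lowerLaplacian_le_of_isLocalMax (u := fun w => Real.log (ρ w)) ?_ hLap
    (hρ.eventually_continuousAt_log hG (hKG hx) hρx) ?_
  · have h2 := (hρ.sq_le_lowerLaplacian (hKG hx) hρx).trans h1
    rw [EReal.coe_le_coe_iff] at h2
    have h3 := h2.trans hL
    rw [le_inv_comm₀ (by positivity) (by positivity), ← one_div,
      le_div_iff₀ (by positivity)] at h3
    nlinarith
  · filter_upwards [hgev, hKx, hρ.eventually_pos hG (hKG hx) hρx] with w h2 h3 h4
    rw [sub_neg_eq_add, sub_neg_eq_add, ← Real.log_mul h4.2.ne' h2.ne',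
      ← Real.log_mul hρx.ne' hgx.ne']
    exact Real.log_le_log (mul_pos h4.2 h2) (hmax h3)
  · filter_upwards [hgev, hKev] with w h2 h3
    exact ((hg.continuousAt h3).log h2.ne').neg

/-- Comparison with the hyperbolic metric of a disc. -/
theorem IsSKMetric.le_hyperbolic_disc (hρ : IsSKMetric G ρ) (hG : IsOpen G) (hR : 0 < R)
    (hsub : closedBall c R ⊆ G) (hz : z ∈ closedBall c R) :
    ρ z * ((R ^ 2 - ‖z - c‖ ^ 2) / (2 * R)) ≤ 1 := by
  refine hρ.mul_le_one hG (isCompact_closedBall c R) hsub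
    (g := fun z => (R ^ 2 - ‖z - c‖ ^ 2) / (2 * R)) (by fun_prop) (fun x hx hgx => ?_) hz
  have hs : 0 < R ^ 2 - ‖x - c‖ ^ 2 := by
    by_contra! h
    exact absurd hgx (not_lt.2 (div_nonpos_of_nonpos_of_nonneg h (by positivity)))
  have hxR : ‖x - c‖ < R := by
    by_contra! h
    nlinarith
  refine ⟨mem_of_superset (isOpen_ball.mem_nhds (mem_ball_iff_norm.2 hxR)) ball_subset_closedBall,
    4 * (R ^ 2 - ‖x - c‖ ^ 2)⁻¹ + 4 * ‖x - c‖ ^ 2 * ((R ^ 2 - ‖x - c‖ ^ 2) ^ 2)⁻¹, ?_, ?_⟩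
  · apply le_of_eq
    field_simp
    ring
  · refine hasMeanLaplacianAt_radial (φ := fun t => -Real.log ((R ^ 2 - t) / (2 * R)))
      (φ' := fun t => (R ^ 2 - t)⁻¹) ?_ ?_
    · filter_upwards [eventually_lt_nhds (show ‖x - c‖ ^ 2 < R ^ 2 by linarith)] with t ht
      have h0 : (R ^ 2 - t) / (2 * R) ≠ 0 := (div_pos (by linarith) (by positivity)).ne'
      have h1 : R ^ 2 - t ≠ 0 := by linarith
      have := ((((hasDerivAt_id t).const_sub (R ^ 2)).div_const (2 * R)).log h0).neg
      refine this.congr_deriv ?_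
      simp only [id]
      field_simp
    · have := ((hasDerivAt_id (‖x - c‖ ^ 2)).const_sub (R ^ 2)).inv hs.ne'
      convert! this using 1
      rw [neg_neg, one_div, id]

/-- Comparison with the hyperbolic metric of the annulus `|log ‖z - a‖| < π / (2 α)`. -/
theorem IsSKMetric.le_hyperbolic_annulus (hρ : IsSKMetric G ρ) (hG : IsOpen G) {a : ℂ} {α : ℝ}
    (hα : 0 < α) (hsub : {a}ᶜ ⊆ G) (hza : z ≠ a)
    (hz : |Real.log ‖z - a‖| ≤ Real.pi / (2 * α)) :
    ρ z * (‖z - a‖ * Real.cos (α * Real.log ‖z - a‖) / α) ≤ 1 := by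
  set b := Real.pi / (2 * α) with hb
  have hbα : α * b = Real.pi / 2 := by rw [hb]; field_simp
  set K : Set ℂ := {w | Real.exp (-b) ≤ ‖w - a‖ ∧ ‖w - a‖ ≤ Real.exp b} with hK
  have hne : ∀ w ∈ K, w ≠ a := by
    rintro w hw rfl
    have := hw.1
    simp only [sub_self, norm_zero] at this
    exact absurd this (not_le.2 (Real.exp_pos _))
  have hKc : IsCompact K := by
    refine (isCompact_closedBall a (Real.exp b)).of_isClosed_subset ?_ fun w hw => ?_
    · have hn : Continuous fun w : ℂ => ‖w - a‖ := by fun_prop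
      exact (isClosed_le continuous_const hn).inter (isClosed_le hn continuous_const)
    · exact mem_closedBall_iff_norm.2 hw.2
  have hzK : z ∈ K := by
    have h0 : 0 < ‖z - a‖ := norm_pos_iff.2 (sub_ne_zero.2 hza)
    rw [abs_le] at hz
    exact ⟨(Real.le_log_iff_exp_le h0).1 hz.1, (Real.log_le_iff_le_exp h0).1 hz.2⟩
  have hlogc : ∀ w ≠ a, ContinuousAt (fun w => Real.log ‖w - a‖) w := fun w hw =>
    ContinuousAt.log (by fun_prop) (norm_ne_zero_iff.2 (sub_ne_zero.2 hw))
  have hgc : ∀ w ≠ a,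
      ContinuousAt (fun w => ‖w - a‖ * Real.cos (α * Real.log ‖w - a‖) / α) w := fun w hw => by
    have := hlogc w hw
    fun_prop
  refine hρ.mul_le_one hG hKc (fun w hw => hsub (hne w hw))
    (g := fun w => ‖w - a‖ * Real.cos (α * Real.log ‖w - a‖) / α)
    (fun w hw => (hgc w (hne w hw)).continuousWithinAt) (fun x hx hgx => ?_) hzK
  have hxa := hne x hx
  have hs : 0 < ‖x - a‖ := norm_pos_iff.2 (sub_ne_zero.2 hxa)
  have hcos : 0 < Real.cos (α * Real.log ‖x - a‖) := by
    by_contra! h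
    refine absurd hgx (not_lt.2 (div_nonpos_of_nonpos_of_nonneg ?_ hα.le))
    exact mul_nonpos_of_nonneg_of_nonpos hs.le h
  refine ⟨?_, α ^ 2 / (‖x - a‖ ^ 2 * Real.cos (α * Real.log ‖x - a‖) ^ 2), ?_, ?_⟩
  · -- the cosine vanishes on the two boundary circles
    have h1 : Real.exp (-b) < ‖x - a‖ := by
      refine lt_of_le_of_ne hx.1 fun h => hcos.ne' ?_
      rw [← h, Real.log_exp, mul_neg, hbα, Real.cos_neg, Real.cos_pi_div_two]
    have h2 : ‖x - a‖ < Real.exp b := by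
      refine lt_of_le_of_ne hx.2 fun h => hcos.ne' ?_
      rw [h, Real.log_exp, hbα, Real.cos_pi_div_two]
    have hc : ContinuousAt (fun w => ‖w - a‖) x := by fun_prop
    filter_upwards [hc.eventually_const_lt h1, hc.eventually_lt_const h2] with w h3 h4
    exact ⟨h3.le, h4.le⟩
  · apply le_of_eq
    field_simp
  · set β := α / 2 with hβ
    have hhalf : ∀ y : ℝ, 0 ≤ y → β * Real.log (y ^ 2) = α * Real.log y := fun y _ => by
      rw [Real.log_pow, hβ]; push_cast; ring
    have hcx : Real.cos (β * Real.log (‖x - a‖ ^ 2)) ≠ 0 := by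
      rw [hhalf _ hs.le]; exact hcos.ne'
    have hsq : 0 < ‖x - a‖ ^ 2 := by positivity
    have hrad := hasMeanLaplacianAt_radial (a := a) (z := x)
      (φ := fun t => -(1 / 2 * Real.log t) - Real.log (Real.cos (β * Real.log t)) + Real.log α)
      (φ' := fun t => -(1 / 2 * t⁻¹) + β * t⁻¹ * Real.tan (β * Real.log t))
      (φ'' := 1 / 2 * ((‖x - a‖ ^ 2) ^ 2)⁻¹
        - β * ((‖x - a‖ ^ 2) ^ 2)⁻¹ * Real.tan (β * Real.log (‖x - a‖ ^ 2))
        + β ^ 2 * ((‖x - a‖ ^ 2) ^ 2)⁻¹ / Real.cos (β * Real.log (‖x - a‖ ^ 2)) ^ 2) ?_ ?_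
    · have hev : ∀ᶠ w in 𝓝 x, w ≠ a ∧ 0 < Real.cos (α * Real.log ‖w - a‖) := by
        refine (isOpen_ne.eventually_mem hxa).and ?_
        have : ContinuousAt (fun w => Real.cos (α * Real.log ‖w - a‖)) x := by
          have := hlogc x hxa
          fun_prop
        exact this.eventually_const_lt hcos
      have h1 := hrad.congr
        (v := fun w => -Real.log (‖w - a‖ * Real.cos (α * Real.log ‖w - a‖) / α))
        (by
          filter_upwards [hev] with w hw
          have hw0 : 0 < ‖w - a‖ := norm_pos_iff.2 (sub_ne_zero.2 hw.1)
          rw [hhalf _ hw0.le, Real.log_div (mul_pos hw0 hw.2).ne' hα.ne',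
            Real.log_mul hw0.ne' hw.2.ne', Real.log_pow]
          push_cast
          ring)
      convert h1 using 1
      rw [hhalf _ hs.le, hβ]
      field_simp
      ring
    · have hcev : ∀ᶠ t in 𝓝 (‖x - a‖ ^ 2), Real.cos (β * Real.log t) ≠ 0 := by
        have : ContinuousAt (fun t => Real.cos (β * Real.log t)) (‖x - a‖ ^ 2) := by
          have := Real.continuousAt_log hsq.ne'
          fun_prop
        exact this.eventually_ne hcx
      filter_upwards [hcev, lt_mem_nhds hsq] with t h1 h2
      have d1 := Real.hasDerivAt_log h2.ne'
      have d2 := ((d1.const_mul β).cos).log h1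
      have d3 := ((d1.const_mul (1 / 2)).neg.sub d2).add_const (Real.log α)
      convert! d3 using 1
      rw [Real.tan_eq_sin_div_cos]
      ring
    · have d1 := Real.hasDerivAt_log hsq.ne'
      have d2 := (Real.hasDerivAt_tan hcx).comp (‖x - a‖ ^ 2) (d1.const_mul β)
      have d0 := hasDerivAt_inv hsq.ne'
      have d3 := ((d0.const_mul (1 / 2)).neg).add ((d0.const_mul β).mul d2)
      convert! d3 using 1
      simp only [Function.comp]
      field_simp
      ring

/-- A punctured plane carries no SK-metric, as the hyperbolic metrics of the annuli exhausting it
tend to zero. -/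
lemma IsSKMetric.eq_zero_of_compl_singleton_subset (hρ : IsSKMetric G ρ) (hG : IsOpen G) {a : ℂ}
    (hsub : {a}ᶜ ⊆ G) (hza : z ≠ a) : ρ z = 0 := by
  refine le_antisymm ?_ (hρ.nonneg z (hsub hza))
  have h0 : 0 < ‖z - a‖ := norm_pos_iff.2 (sub_ne_zero.2 hza)
  have hl : Tendsto (fun α : ℝ => ρ z * (‖z - a‖ * Real.cos (α * Real.log ‖z - a‖))) (𝓝[>] 0)
      (𝓝 (ρ z * (‖z - a‖ * Real.cos (0 * Real.log ‖z - a‖)))) := by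
    have : Continuous fun α : ℝ => ρ z * (‖z - a‖ * Real.cos (α * Real.log ‖z - a‖)) := by
      fun_prop
    exact (this.tendsto 0).mono_left nhdsWithin_le_nhds
  have hr : Tendsto (fun α : ℝ => α) (𝓝[>] 0) (𝓝 0) := tendsto_id.mono_left nhdsWithin_le_nhds
  have hsmall : ∀ᶠ α : ℝ in 𝓝[>] 0, α * |Real.log ‖z - a‖| ≤ Real.pi / 2 := by
    have : Continuous fun α : ℝ => α * |Real.log ‖z - a‖| := by fun_prop
    have h2 := (this.tendsto 0).mono_left (nhdsWithin_le_nhds (s := Ioi 0))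
    rw [zero_mul] at h2
    exact h2.eventually_le_const (by positivity)
  have hle := le_of_tendsto_of_tendsto hl hr (by
    filter_upwards [hsmall, self_mem_nhdsWithin] with α h1 h2
    have hα : 0 < α := h2
    have h3 := hρ.le_hyperbolic_annulus hG hα hsub hza (by
      rw [le_div_iff₀ (by positivity)]
      linarith)
    rw [← mul_div_assoc, div_le_one hα] at h3
    exact h3)
  rw [zero_mul, Real.cos_zero, mul_one] at hle
  exact nonpos_of_mul_nonpos_left hle h0

lemma IsSKMetric.compl_nontrivial (hρ : IsSKMetric G ρ) (hG : IsOpen G) : Gᶜ.Nontrivial := by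
  by_contra h
  rw [Set.not_nontrivial_iff] at h
  obtain ⟨z, hz, hρz⟩ := hρ.not_identically_zero
  obtain ⟨a, hza, hsub⟩ : ∃ a, z ≠ a ∧ {a}ᶜ ⊆ G := by
    rcases h.eq_empty_or_singleton with h | ⟨a, h⟩
    · refine ⟨z + 1, by simp, ?_⟩
      rw [Set.compl_empty_iff.1 h]
      exact subset_univ _
    · refine ⟨a, ?_, by rw [← h, compl_compl]⟩
      rintro rfl
      exact (h ▸ mem_singleton z : z ∈ Gᶜ) hz
  exact hρz (hρ.eq_zero_of_compl_singleton_subset hG hsub hza)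

end SK

/-! ### An explicit SK-metric, comparison and gluing -/

section Positive

/-- With `x = t ^ (1/6)`, this is `log ((1 + x) / x ^ 5) / 2`; as a function of `t = ‖z - a‖ ^ 2` it
is the contribution of the puncture `a` to the logarithm of an SK-metric on a twice punctured
plane. -/
noncomputable def puncturePotential (t : ℝ) : ℝ :=
  1 / 2 * Real.log (1 + Real.exp (Real.log t / 6)) - 5 / 12 * Real.log t

variable {a b z : ℂ}

lemma hasMeanLaplacianAt_puncturePotential (hz : z ≠ a) {x : ℝ}
    (hx : x = Real.exp (Real.log (‖z - a‖ ^ 2) / 6)) :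
    HasMeanLaplacianAt (fun w => puncturePotential (‖w - a‖ ^ 2))
      (1 / (18 * x ^ 5 * (1 + x) ^ 2)) z := by
  have hs : 0 < ‖z - a‖ ^ 2 := pow_pos (norm_pos_iff.2 (sub_ne_zero.2 hz)) 2
  have hx0 : 0 < x := hx ▸ Real.exp_pos _
  have hx6 : x ^ 6 = ‖z - a‖ ^ 2 := by
    rw [hx, ← Real.exp_nat_mul]
    push_cast
    rw [mul_div_cancel₀ _ (by norm_num), Real.exp_log hs]
  have dX : ∀ t : ℝ, 0 < t → HasDerivAt (fun t => 1 + Real.exp (Real.log t / 6))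
      (Real.exp (Real.log t / 6) * (t⁻¹ / 6)) t := fun t ht =>
    (((Real.hasDerivAt_log ht.ne').div_const 6).exp).const_add 1
  have hpos : ∀ t : ℝ, 0 < 1 + Real.exp (Real.log t / 6) := fun t => by positivity
  have h := hasMeanLaplacianAt_radial (φ := puncturePotential) (a := a) (z := z)
    (φ' := fun t => 1 / 2 *
        (Real.exp (Real.log t / 6) * (t⁻¹ / 6) / (1 + Real.exp (Real.log t / 6))) - 5 / 12 * t⁻¹)
    (φ'' := 1 / 2 * (((x * (x ^ 6)⁻¹ / 6 * ((x ^ 6)⁻¹ / 6) - x * (((x ^ 6) ^ 2)⁻¹ / 6)) * (1 + x)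
      - x * ((x ^ 6)⁻¹ / 6) * (x * ((x ^ 6)⁻¹ / 6))) / (1 + x) ^ 2) + 5 / 12 * ((x ^ 6) ^ 2)⁻¹)
    ?_ ?_
  · convert h using 1
    rw [← hx, ← hx6]
    field_simp
    ring
  · filter_upwards [lt_mem_nhds hs] with t ht
    have d1 := (((dX t ht).log (hpos t).ne').const_mul (1 / 2)).sub
      ((Real.hasDerivAt_log ht.ne').const_mul (5 / 12))
    exact d1
  · have dE : HasDerivAt (fun t => Real.exp (Real.log t / 6))
        (Real.exp (Real.log (‖z - a‖ ^ 2) / 6) * ((‖z - a‖ ^ 2)⁻¹ / 6)) (‖z - a‖ ^ 2) :=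
      ((Real.hasDerivAt_log hs.ne').div_const 6).exp
    have dI := hasDerivAt_inv hs.ne'
    have d1 := (((dE.mul (dI.div_const 6)).div (dX _ hs) (hpos _).ne').const_mul (1 / 2)).sub
      (dI.const_mul (5 / 12))
    refine d1.congr_deriv ?_
    simp only [Pi.mul_apply]
    rw [← hx, ← hx6]
    field_simp
    ring

lemma continuousAt_puncturePotential (hz : z ≠ a) :
    ContinuousAt (fun w => puncturePotential (‖w - a‖ ^ 2)) z := by
  have hs : ‖z - a‖ ^ 2 ≠ 0 := pow_ne_zero 2 (norm_ne_zero_iff.2 (sub_ne_zero.2 hz))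
  have h1 : ContinuousAt (fun w => Real.log (‖w - a‖ ^ 2)) z := ContinuousAt.log (by fun_prop) hs
  have h2 : ContinuousAt (fun w => Real.log (1 + Real.exp (Real.log (‖w - a‖ ^ 2) / 6))) z :=
    ContinuousAt.log (by fun_prop) (by positivity)
  unfold puncturePotential
  fun_prop

lemma exp_two_mul_puncturePotential {x : ℝ} {t : ℝ} (hx : x = Real.exp (Real.log t / 6)) :
    Real.exp (2 * puncturePotential t) = (1 + x) / x ^ 5 := by
  have hx0 : 0 < x := hx ▸ Real.exp_pos _
  have h1 : Real.log t = 6 * Real.log x := by rw [hx, Real.log_exp]; ring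
  have h2 : 2 * puncturePotential t = Real.log ((1 + x) / x ^ 5) := by
    rw [Real.log_div (by positivity) (by positivity), Real.log_pow, puncturePotential, ← hx, h1]
    push_cast
    ring
  rw [h2, Real.exp_log (by positivity)]

/-- The curvature estimate for the explicit metric, in terms of the cube roots `x`, `y` of the
distances to the punctures; at least one of them is bounded below by `x₀`. -/
lemma puncture_inequality {x₀ x y : ℝ} (hx₀ : 0 < x₀) (hy : 0 < y) (hx : x₀ ≤ x) (hyx : y ≤ x) :
    x₀ / (18 * (1 + 1 / x₀) ^ 4) * ((1 + x) / x ^ 5 * ((1 + y) / y ^ 5))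
      ≤ 1 / (18 * y ^ 5 * (1 + y) ^ 2) := by
  have hx0 : 0 < x := hx₀.trans_le hx
  have h1 : 1 + x ≤ (1 + 1 / x₀) * x := by
    rw [add_mul, one_mul, div_mul_eq_mul_div, one_mul]
    have : 1 ≤ x / x₀ := (one_le_div hx₀).2 hx
    linarith
  have h2 : (1 + x) * (1 + y) ^ 3 ≤ (1 + 1 / x₀) ^ 4 * x ^ 4 := by
    calc (1 + x) * (1 + y) ^ 3 ≤ (1 + x) * (1 + x) ^ 3 := by gcongr
      _ = (1 + x) ^ 4 := by ring
      _ ≤ ((1 + 1 / x₀) * x) ^ 4 := by gcongr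
      _ = _ := by ring
  have h3 : x₀ * ((1 + x) * (1 + y) ^ 3) ≤ (1 + 1 / x₀) ^ 4 * x ^ 5 := by
    calc x₀ * ((1 + x) * (1 + y) ^ 3) ≤ x * ((1 + 1 / x₀) ^ 4 * x ^ 4) := by gcongr
      _ = _ := by ring
  have hk : 0 < (1 + 1 / x₀) ^ 4 := by positivity
  set k := (1 + 1 / x₀) ^ 4 with hkdef
  have e : x₀ / (18 * k) * ((1 + x) / x ^ 5 * ((1 + y) / y ^ 5))
      = x₀ * ((1 + x) * (1 + y) ^ 3) / (18 * k * x ^ 5 * y ^ 5 * (1 + y) ^ 2) := by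
    field_simp
  rw [e, div_le_div_iff₀ (by positivity) (by positivity), one_mul]
  calc x₀ * ((1 + x) * (1 + y) ^ 3) * (18 * y ^ 5 * (1 + y) ^ 2)
      ≤ (k * x ^ 5) * (18 * y ^ 5 * (1 + y) ^ 2) := by gcongr
    _ = _ := by ring

/-- An explicit SK-metric with positive density on any domain omitting two points. -/
theorem exists_pos_isSKMetric {G : Set ℂ} (hG : IsOpen G) (hne : G.Nonempty) (hab : a ≠ b)
    (ha : a ∉ G) (hb : b ∉ G) : ∃ σ, IsSKMetric G σ ∧ ∀ z ∈ G, 0 < σ z := by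
  set d := ‖a - b‖ with hd
  have hd0 : 0 < d := norm_pos_iff.2 (sub_ne_zero.2 hab)
  set x₀ := min 1 (d / 2) with hx₀
  have hx₀0 : 0 < x₀ := by positivity
  have hx₀d : x₀ ^ 3 ≤ d / 2 :=
    (pow_le_of_le_one hx₀0.le (min_le_left _ _) (by norm_num)).trans (min_le_right _ _)
  set k := x₀ / (18 * (1 + 1 / x₀) ^ 4) with hk
  have hk0 : 0 < k := by positivity
  set σ : ℂ → ℝ := fun z => √k *
    Real.exp (puncturePotential (‖z - a‖ ^ 2) + puncturePotential (‖z - b‖ ^ 2)) with hσ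
  have hpos : ∀ z, 0 < σ z := fun z => by positivity
  have hza : ∀ z ∈ G, z ≠ a := fun z hz h => ha (h ▸ hz)
  have hzb : ∀ z ∈ G, z ≠ b := fun z hz h => hb (h ▸ hz)
  have hconf : IsConformalPseudoMetric G σ := by
    refine ⟨fun z hz => ContinuousAt.continuousWithinAt ?_, fun z _ => (hpos z).le, ?_⟩
    · exact continuousAt_const.mul ((continuousAt_puncturePotential (hza z hz)).add
        (continuousAt_puncturePotential (hzb z hz))).rexp
    · obtain ⟨z, hz⟩ := hne
      exact ⟨z, hz, (hpos z).ne'⟩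
  refine ⟨σ, ⟨hconf, fun z hz h => ?_⟩, fun z _ => hpos z⟩
  rw [lowerCurvature_le_neg_one_iff h]
  obtain ⟨x, hx⟩ : ∃ x, x = Real.exp (Real.log (‖z - a‖ ^ 2) / 6) := ⟨_, rfl⟩
  obtain ⟨y, hy⟩ : ∃ y, y = Real.exp (Real.log (‖z - b‖ ^ 2) / 6) := ⟨_, rfl⟩
  have hx0 : 0 < x := hx ▸ Real.exp_pos _
  have hy0 : 0 < y := hy ▸ Real.exp_pos _
  have hcube : ∀ {t : ℝ} {s : ℝ}, 0 < t → s = Real.exp (Real.log (t ^ 2) / 6) → s ^ 3 = t := by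
    intro t s ht hs
    rw [hs, ← Real.exp_nat_mul, Real.log_pow]
    push_cast
    rw [show 3 * (2 * Real.log t / 6) = Real.log t by ring, Real.exp_log ht]
  have hx3 := hcube (norm_pos_iff.2 (sub_ne_zero.2 (hza z hz))) hx
  have hy3 := hcube (norm_pos_iff.2 (sub_ne_zero.2 (hzb z hz))) hy
  have hcontA : ∀ᶠ w in 𝓝 z, ContinuousAt (fun w => puncturePotential (‖w - a‖ ^ 2)) w := by
    filter_upwards [hG.mem_nhds hz] with w hw using continuousAt_puncturePotential (hza w hw)
  have hcontB : ∀ᶠ w in 𝓝 z, ContinuousAt (fun w => puncturePotential (‖w - b‖ ^ 2)) w := by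
    filter_upwards [hG.mem_nhds hz] with w hw using continuousAt_puncturePotential (hzb w hw)
  have hlog : ∀ w, puncturePotential (‖w - a‖ ^ 2) + puncturePotential (‖w - b‖ ^ 2)
      + Real.log √k = Real.log (σ w) := by
    intro w
    rw [hσ, Real.log_mul (by positivity) (by positivity), Real.log_exp, add_comm]
  have hL := (((hasMeanLaplacianAt_puncturePotential (hza z hz) hx).add
    (hasMeanLaplacianAt_puncturePotential (hzb z hz) hy) hcontA hcontB).add_const
    (Real.log √k) (by
      filter_upwards [hcontA, hcontB] with w h1 h2 using h1.add h2)).congr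
    (Eventually.of_forall hlog)
  rw [hL.lowerLaplacian_eq, EReal.coe_le_coe_iff]
  have hsq : σ z ^ 2 = k * ((1 + x) / x ^ 5 * ((1 + y) / y ^ 5)) := by
    rw [hσ, mul_pow, Real.sq_sqrt hk0.le, ← Real.exp_nat_mul]
    push_cast
    rw [mul_add, Real.exp_add, exp_two_mul_puncturePotential hx, exp_two_mul_puncturePotential hy]
  rw [hsq]
  have htri : d ≤ x ^ 3 + y ^ 3 := by
    rw [hx3, hy3, hd, ← norm_neg (z - a)]
    refine le_trans (le_of_eq ?_) (norm_add_le _ _)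
    congr 1
    ring
  have hX : 0 < 1 / (18 * x ^ 5 * (1 + x) ^ 2) := by positivity
  have hY : 0 < 1 / (18 * y ^ 5 * (1 + y) ^ 2) := by positivity
  rcases le_total y x with hyx | hxy
  · have hx1 : x₀ ≤ x := by
      by_contra! hlt
      have h1 : y ^ 3 ≤ x ^ 3 := by gcongr
      have h2 : x ^ 3 < x₀ ^ 3 := by gcongr
      linarith
    have := puncture_inequality hx₀0 hy0 hx1 hyx
    linarith
  · have hy1 : x₀ ≤ y := by
      by_contra! hlt
      have h1 : x ^ 3 ≤ y ^ 3 := by gcongr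
      have h2 : y ^ 3 < x₀ ^ 3 := by gcongr
      linarith
    have := puncture_inequality hx₀0 hx0 hy1 hxy
    rw [mul_comm ((1 + x) / x ^ 5)]
    linarith

end Positive

section Gluing

open Metric

variable {G : Set ℂ} {ρ σ : ℂ → ℝ} {c z : ℂ} {R : ℝ} {u V : ℂ → ℝ}

/-- Comparison principle: subsolutions of Liouville's equation lie below solutions. -/
theorem IsLiouvilleSolution.le_add (hV : IsLiouvilleSolution V c R)
    (hu : ContinuousOn u (closedBall c R))
    (hsub : ∀ z ∈ ball c R, ((Real.exp (2 * u z) : ℝ) : EReal) ≤ lowerLaplacian u z) {ε : ℝ}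
    (hε : 0 ≤ ε) (hb : ∀ w ∈ sphere c R, u w ≤ V w + ε) (hz : z ∈ closedBall c R) :
    u z ≤ V z + ε := by
  by_contra! hlt
  obtain ⟨x, hx, hεx, hmax⟩ := exists_isLocalMax_of_lt hu hV.continuousOn (a := ε)
    (fun w hw => by linarith [hb w hw]) hz (by linarith)
  have h1 := (hsub x hx).trans (lowerLaplacian_le_of_isLocalMax hmax (hV.hasMeanLaplacianAt x hx)
    (eventually_continuousAt_of_mem_ball hu hx)
    (eventually_continuousAt_of_mem_ball hV.continuousOn hx))
  rw [EReal.coe_le_coe_iff, Real.exp_le_exp] at h1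
  linarith

lemma exp_two_mul_log {t : ℝ} (ht : 0 < t) : Real.exp (2 * Real.log t) = t ^ 2 := by
  rw [two_mul, Real.exp_add, Real.exp_log ht, sq]

lemma IsSKMetric.log_le_of_liouville (hρ : IsSKMetric G ρ) (hpos : ∀ z ∈ G, 0 < ρ z)
    (hsub : closedBall c R ⊆ G) (hV : IsLiouvilleSolution V c R)
    (hb : ∀ w ∈ sphere c R, Real.log (ρ w) ≤ V w) (hz : z ∈ closedBall c R) :
    Real.log (ρ z) ≤ V z := by
  have h := hV.le_add (u := fun w => Real.log (ρ w)) (ε := 0) ?_ ?_ le_rfl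
    (fun w hw => by simpa using hb w hw) hz
  · simpa using h
  · exact (hρ.continuousOn.mono hsub).log fun w hw => (hpos w (hsub hw)).ne'
  · intro w hw
    have hwG := hsub (ball_subset_closedBall hw)
    rw [exp_two_mul_log (hpos w hwG)]
    exact hρ.sq_le_lowerLaplacian hwG (hpos w hwG)

open Classical in
/-- Replacing a positive SK-metric in a disc by the solution of Liouville's equation with the same
boundary values yields a larger SK-metric. -/
theorem IsSKMetric.glue (hρ : IsSKMetric G ρ) (hG : IsOpen G) (hpos : ∀ z ∈ G, 0 < ρ z)
    (hR : 0 < R) (hsub : closedBall c R ⊆ G) (hV : IsLiouvilleSolution V c R)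
    (hb : ∀ w ∈ sphere c R, V w = Real.log (ρ w)) :
    IsSKMetric G ((closedBall c R).piecewise (fun z => Real.exp (V z)) ρ) := by
  set τ := (closedBall c R).piecewise (fun z => Real.exp (V z)) ρ with hτ
  have hin : ∀ w ∈ closedBall c R, τ w = Real.exp (V w) := fun w hw => piecewise_eq_of_mem _ _ _ hw
  have hout : ∀ w ∉ closedBall c R, τ w = ρ w := fun w hw => piecewise_eq_of_notMem _ _ _ hw
  have hτpos : ∀ w ∈ G, 0 < τ w := by
    intro w hw
    by_cases h : w ∈ closedBall c R
    · rw [hin w h]; positivity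
    · rw [hout w h]; exact hpos w hw
  have hle : ∀ w ∈ G, ρ w ≤ τ w := by
    intro w hw
    by_cases h : w ∈ closedBall c R
    · rw [hin w h, ← Real.log_le_iff_le_exp (hpos w hw)]
      exact hρ.log_le_of_liouville hpos hsub hV (fun x hx => (hb x hx).ge) h
    · rw [hout w h]
  have hconf : IsConformalPseudoMetric G τ := by
    refine ⟨?_, fun w hw => (hτpos w hw).le, ?_⟩
    · refine ContinuousOn.piecewise ?_ ?_ ?_
      · rintro w ⟨hw, hw'⟩
        rw [frontier_closedBall c hR.ne'] at hw'
        rw [hb w hw', Real.exp_log (hpos w hw)]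
      · rw [isClosed_closedBall.closure_eq]
        exact (hV.continuousOn.mono inter_subset_right).rexp
      · exact hρ.continuousOn.mono inter_subset_left
    · obtain ⟨w, hw, -⟩ := hρ.not_identically_zero
      exact ⟨w, hw, (hτpos w hw).ne'⟩
  refine ⟨hconf, fun w hw h => ?_⟩
  by_cases hwb : w ∈ ball c R
  · rw [lowerCurvature_le_neg_one_iff h]
    have hL : HasMeanLaplacianAt (fun x => Real.log (τ x)) (Real.exp (2 * V w)) w := by
      refine (hV.hasMeanLaplacianAt w hwb).congr ?_
      filter_upwards [isOpen_ball.mem_nhds hwb] with x hx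
      rw [hin x (ball_subset_closedBall hx), Real.log_exp]
    rw [hL.lowerLaplacian_eq, hin w (ball_subset_closedBall hwb), EReal.coe_le_coe_iff,
      ← Real.exp_nat_mul]
    push_cast
    exact le_rfl
  · refine hρ.lowerCurvature_le_of_touching hG hconf hw h ?_ ?_
    · by_cases hwc : w ∈ closedBall c R
      · have hws : w ∈ sphere c R := by
          rw [mem_sphere]; rw [mem_ball, not_lt] at hwb
          exact le_antisymm hwc hwb
        rw [hin w hwc, hb w hws, Real.exp_log (hpos w hw)]
      · exact (hout w hwc).symm
    · filter_upwards [hG.mem_nhds hw] with x hx using hle x hx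

end Gluing

/-! ### The supremum of all SK-metrics -/

section Maximal

open Metric

variable {G : Set ℂ} {ρ σ : ℂ → ℝ} {c z : ℂ} {R : ℝ}

/-- Near each point of `G` all SK-metrics on `G` obey a common bound. -/
lemma exists_uniform_bound (hG : IsOpen G) (hc : c ∈ G) :
    ∃ r > 0, closedBall c r ⊆ G ∧ ∃ M : ℝ, ∀ ρ, IsSKMetric G ρ →
      ∀ z ∈ closedBall c r, ρ z ≤ Real.exp M := by
  obtain ⟨δ, hδ, hsub⟩ := Metric.nhds_basis_closedBall.mem_iff.1 (hG.mem_nhds hc)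
  have hδ' : 0 < δ := hδ
  refine ⟨δ / 2, by positivity, (closedBall_subset_closedBall (by linarith)).trans hsub,
    Real.log (8 / (3 * δ)), fun ρ hρ z hz => ?_⟩
  have h1 := hρ.le_hyperbolic_disc hG hδ' hsub
    (closedBall_subset_closedBall (by linarith : δ / 2 ≤ δ) hz)
  have h2 : ‖z - c‖ ^ 2 ≤ (δ / 2) ^ 2 := by
    have := mem_closedBall_iff_norm.1 hz
    gcongr
  have h3 : 3 * δ / 8 ≤ (δ ^ 2 - ‖z - c‖ ^ 2) / (2 * δ) := by
    rw [le_div_iff₀ (by positivity)]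
    nlinarith
  rw [Real.exp_log (by positivity), le_div_iff₀ (by positivity)]
  have h4 := mul_le_mul_of_nonneg_left h3
    (hρ.nonneg z (hsub (closedBall_subset_closedBall (by linarith) hz)))
  linarith

lemma bddAbove_values (hG : IsOpen G) (hz : z ∈ G) :
    BddAbove {x : ℝ | ∃ ρ ∈ skMetrics G, ρ z = x} := by
  obtain ⟨r, hr, -, M, hM⟩ := exists_uniform_bound hG hz
  refine ⟨Real.exp M, ?_⟩
  rintro x ⟨ρ, hρ, rfl⟩
  exact hM ρ hρ z (mem_closedBall_self hr.le)

lemma isLUB_hyperbolicDensity (hG : IsOpen G) (hne : (skMetrics G).Nonempty) (hz : z ∈ G) :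
    IsLUB {x : ℝ | ∃ ρ ∈ skMetrics G, ρ z = x} (hyperbolicDensity G z) := by
  obtain ⟨ρ, hρ⟩ := hne
  exact isLUB_csSup ⟨_, ρ, hρ, rfl⟩ (bddAbove_values hG hz)

lemma IsSKMetric.le_hyperbolicDensity (hG : IsOpen G) (hρ : IsSKMetric G ρ) (hz : z ∈ G) :
    ρ z ≤ hyperbolicDensity G z :=
  le_csSup (bddAbove_values hG hz) ⟨ρ, hρ, rfl⟩

lemma hyperbolicDensity_le (hne : (skMetrics G).Nonempty) {M : ℝ}
    (h : ∀ ρ, IsSKMetric G ρ → ρ z ≤ M) : hyperbolicDensity G z ≤ M := by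
  obtain ⟨ρ, hρ⟩ := hne
  refine csSup_le ⟨_, ρ, hρ, rfl⟩ ?_
  rintro x ⟨ρ, hρ, rfl⟩
  exact h ρ hρ

/-- Discs on which the Dirichlet problem for Liouville's equation is solvable for boundary values
bounded by a common bound for all SK-metrics. -/
lemma exists_dirichlet_disc (hG : IsOpen G) (hc : c ∈ G) :
    ∃ R > 0, closedBall c R ⊆ G ∧ ∃ M : ℝ,
      (∀ ρ, IsSKMetric G ρ → ∀ z ∈ closedBall c R, ρ z ≤ Real.exp M) ∧
      ∀ m : ℝ, ∃ L : ℝ, ∀ φ : ℂ → ℝ, ContinuousOn φ (sphere c R) → (∀ w ∈ sphere c R, φ w ≤ M) →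
        ∃ V, IsLiouvilleSolution V c R ∧ (∀ w ∈ sphere c R, V w = φ w) ∧
          ((∀ w ∈ sphere c R, m ≤ φ w) →
            ∀ z ∈ closedBall c (R / 2), |V z - V c| ≤ L * ‖z - c‖) := by
  obtain ⟨r, hr, hsub, M, hM⟩ := exists_uniform_bound hG hc
  obtain ⟨R₀, hR₀, H⟩ := exists_liouvilleSolution M
  refine ⟨min r R₀, lt_min hr hR₀, (closedBall_subset_closedBall (min_le_left _ _)).trans hsub, M,
    fun ρ hρ z hz => hM ρ hρ z (closedBall_subset_closedBall (min_le_left _ _) hz), fun m => ?_⟩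
  obtain ⟨L, hL⟩ := H (min r R₀) (lt_min hr hR₀) (min_le_right _ _) m
  exact ⟨L, hL c⟩

/-- The supremum is continuous: near `c` it is the supremum of the glued metrics, whose logarithms
satisfy a common Lipschitz bound at `c`. -/
theorem continuousAt_hyperbolicDensity (hG : IsOpen G) (hσ : IsSKMetric G σ)
    (hσpos : ∀ z ∈ G, 0 < σ z) (hc : c ∈ G) : ContinuousAt (hyperbolicDensity G) c := by
  classical
  obtain ⟨R, hR, hsub, M, hM, H⟩ := exists_dirichlet_disc hG hc
  have hσlog : ContinuousOn (fun w => Real.log (σ w)) (sphere c R) :=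
    (hσ.continuousOn.mono (sphere_subset_closedBall.trans hsub)).log fun w hw =>
      (hσpos w (hsub (sphere_subset_closedBall hw))).ne'
  obtain ⟨m, hm⟩ := (isCompact_sphere c R).bddBelow_image hσlog
  obtain ⟨L, hL⟩ := H m
  have key : ∀ ρ, IsSKMetric G ρ → ∀ z ∈ closedBall c (R / 2),
      ρ z ≤ hyperbolicDensity G c * Real.exp (L * ‖z - c‖) ∧
      ρ c ≤ hyperbolicDensity G z * Real.exp (L * ‖z - c‖) := by
    intro ρ hρ z hz
    have hzR : z ∈ closedBall c R := closedBall_subset_closedBall (by linarith) hz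
    have hcR : c ∈ closedBall c R := mem_closedBall_self hR.le
    have hρ1 := hρ.max hG hσ
    have hpos : ∀ w ∈ G, 0 < max (ρ w) (σ w) := fun w hw => lt_max_of_lt_right (hσpos w hw)
    obtain ⟨V, hV, hVb, hVL⟩ := hL (fun w => Real.log (max (ρ w) (σ w)))
      ((hρ1.continuousOn.mono (sphere_subset_closedBall.trans hsub)).log fun w hw =>
        (hpos w (hsub (sphere_subset_closedBall hw))).ne')
      (fun w hw => by
        have hw' := sphere_subset_closedBall hw
        rw [Real.log_le_iff_le_exp (hpos w (hsub hw'))]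
        exact hM _ hρ1 w hw')
    have hτ := hρ1.glue hG hpos hR hsub hV hVb
    have hle : ∀ w ∈ closedBall c R, ρ w ≤ Real.exp (V w) := fun w hw => by
      refine (le_max_left (ρ w) (σ w)).trans ?_
      rw [← Real.log_le_iff_le_exp (hpos w (hsub hw))]
      exact hρ1.log_le_of_liouville hpos hsub hV (fun x hx => (hVb x hx).ge) hw
    have hge : ∀ w ∈ closedBall c R, Real.exp (V w) ≤ hyperbolicDensity G w := fun w hw => by
      have := hτ.le_hyperbolicDensity hG (hsub hw)
      rwa [piecewise_eq_of_mem _ _ _ hw] at this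
    have hlip := abs_le.1 (hVL (fun w hw => (hm (mem_image_of_mem _ hw)).trans
      (Real.log_le_log (hσpos w (hsub (sphere_subset_closedBall hw))) (le_max_right _ _))) z hz)
    constructor
    · refine (hle z hzR).trans (le_trans ?_
        (mul_le_mul_of_nonneg_right (hge c hcR) (Real.exp_pos _).le))
      rw [← Real.exp_add, Real.exp_le_exp]
      linarith [hlip.2]
    · refine (hle c hcR).trans (le_trans ?_
        (mul_le_mul_of_nonneg_right (hge z hzR) (Real.exp_pos _).le))
      rw [← Real.exp_add, Real.exp_le_exp]
      linarith [hlip.1]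
  have hne : (skMetrics G).Nonempty := ⟨σ, hσ⟩
  have hb : ∀ᶠ z in 𝓝 c, z ∈ closedBall c (R / 2) := closedBall_mem_nhds c (by positivity)
  have hup : Tendsto (fun z => hyperbolicDensity G c * Real.exp (L * ‖z - c‖)) (𝓝 c)
      (𝓝 (hyperbolicDensity G c)) := by
    have : Continuous fun z => hyperbolicDensity G c * Real.exp (L * ‖z - c‖) := by fun_prop
    simpa using this.tendsto c
  have hlow : Tendsto (fun z => hyperbolicDensity G c * Real.exp (-(L * ‖z - c‖))) (𝓝 c)
      (𝓝 (hyperbolicDensity G c)) := by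
    have : Continuous fun z => hyperbolicDensity G c * Real.exp (-(L * ‖z - c‖)) := by fun_prop
    simpa using this.tendsto c
  refine tendsto_of_tendsto_of_tendsto_of_le_of_le' hlow hup ?_ ?_
  · filter_upwards [hb] with z hz
    have := hyperbolicDensity_le hne fun ρ hρ => (key ρ hρ z hz).2
    rw [Real.exp_neg, ← div_eq_mul_inv, div_le_iff₀ (Real.exp_pos _)]
    exact this
  · filter_upwards [hb] with z hz
    exact hyperbolicDensity_le hne fun ρ hρ => (key ρ hρ z hz).1

lemma hyperbolicDensity_pos (hG : IsOpen G) (hσ : IsSKMetric G σ) (hσpos : ∀ z ∈ G, 0 < σ z)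
    (hz : z ∈ G) : 0 < hyperbolicDensity G z :=
  (hσpos z hz).trans_le (hσ.le_hyperbolicDensity hG hz)

/-- By compactness (Dini's argument for the family of SK-metrics, directed upwards under `max`), the
supremum is uniformly approximated on compact sets by a single SK-metric. -/
lemma exists_uniform_approx (hG : IsOpen G) (hσ : IsSKMetric G σ) (hσpos : ∀ z ∈ G, 0 < σ z)
    {K : Set ℂ} (hK : IsCompact K) (hKG : K ⊆ G) {ε : ℝ} (hε : 0 < ε) :
    ∃ ρ, IsSKMetric G ρ ∧ (∀ z ∈ G, 0 < ρ z) ∧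
      ∀ z ∈ K, Real.log (hyperbolicDensity G z) ≤ Real.log (ρ z) + ε := by
  refine hK.induction_on (p := fun s => ∃ ρ, IsSKMetric G ρ ∧ (∀ z ∈ G, 0 < ρ z) ∧
      ∀ z ∈ s, z ∈ G → Real.log (hyperbolicDensity G z) ≤ Real.log (ρ z) + ε) ?_ ?_ ?_ ?_ |>.imp
    fun ρ h => ⟨h.1, h.2.1, fun z hz => h.2.2 z hz (hKG hz)⟩
  · exact ⟨σ, hσ, hσpos, by simp⟩
  · rintro s t hst ⟨ρ, h1, h2, h3⟩
    exact ⟨ρ, h1, h2, fun z hz => h3 z (hst hz)⟩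
  · rintro s t ⟨ρ, h1, h2, h3⟩ ⟨τ, k1, k2, k3⟩
    refine ⟨_, h1.max hG k1, fun z hz => lt_max_of_lt_left (h2 z hz), ?_⟩
    rintro z (hz | hz) hzG
    · refine (h3 z hz hzG).trans ?_
      gcongr
      · exact h2 z hzG
      · exact le_max_left _ _
    · refine (k3 z hz hzG).trans ?_
      gcongr
      · exact k2 z hzG
      · exact le_max_right _ _
  · intro x hx
    have hxG := hKG hx
    have hΛ := hyperbolicDensity_pos hG hσ hσpos hxG
    obtain ⟨y, ⟨ρ, hρ, rfl⟩, hy⟩ := (lt_isLUB_iff (isLUB_hyperbolicDensity hG ⟨σ, hσ⟩ hxG)).1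
      (show hyperbolicDensity G x * Real.exp (-ε) < hyperbolicDensity G x from
        mul_lt_of_lt_one_right hΛ (by rw [Real.exp_lt_one_iff]; linarith))
    have hρ1 := IsSKMetric.max hG hρ hσ
    have hpos : ∀ w ∈ G, 0 < max (ρ w) (σ w) := fun w hw => lt_max_of_lt_right (hσpos w hw)
    have hc1 : ContinuousAt (fun w => hyperbolicDensity G w * Real.exp (-ε)) x :=
      (continuousAt_hyperbolicDensity hG hσ hσpos hxG).mul continuousAt_const
    have hc2 := hρ1.continuousOn.continuousAt (hG.mem_nhds hxG)
    have hev := hc1.eventually_lt hc2 (hy.trans_le (le_max_left _ _))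
    refine ⟨_, mem_nhdsWithin_of_mem_nhds hev, _, hρ1, hpos, fun z hz hzG => ?_⟩
    have hz' : hyperbolicDensity G z * Real.exp (-ε) < max (ρ z) (σ z) := hz
    have h4 := Real.log_le_log
      (mul_pos (hyperbolicDensity_pos hG hσ hσpos hzG) (Real.exp_pos _)) hz'.le
    rw [Real.log_mul (hyperbolicDensity_pos hG hσ hσpos hzG).ne' (Real.exp_pos _).ne',
      Real.log_exp] at h4
    linarith

/-- Locally the supremum is `exp V` for a solution `V` of Liouville's equation, namely the one with
boundary values `log (hyperbolicDensity G)`. -/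
theorem exists_liouville_eq_hyperbolicDensity (hG : IsOpen G) (hσ : IsSKMetric G σ)
    (hσpos : ∀ z ∈ G, 0 < σ z) (hc : c ∈ G) :
    ∃ R > 0, ∃ V, closedBall c R ⊆ G ∧ IsLiouvilleSolution V c R ∧
      ∀ z ∈ closedBall c R, hyperbolicDensity G z = Real.exp (V z) := by
  classical
  obtain ⟨R, hR, hsub, M, hM, H⟩ := exists_dirichlet_disc hG hc
  have hne : (skMetrics G).Nonempty := ⟨σ, hσ⟩
  have hsph : sphere c R ⊆ G := sphere_subset_closedBall.trans hsub
  have hΛpos : ∀ z ∈ G, 0 < hyperbolicDensity G z := fun z hz =>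
    hyperbolicDensity_pos hG hσ hσpos hz
  obtain ⟨_, hD⟩ := H 0
  obtain ⟨V, hV, hVb, -⟩ := hD (fun w => Real.log (hyperbolicDensity G w))
    (fun w hw => ((continuousAt_hyperbolicDensity hG hσ hσpos (hsph hw)).log
      (hΛpos w (hsph hw)).ne').continuousWithinAt)
    (fun w hw => by
      rw [Real.log_le_iff_le_exp (hΛpos w (hsph hw))]
      exact hyperbolicDensity_le hne fun ρ hρ => hM ρ hρ w (sphere_subset_closedBall hw))
  refine ⟨R, hR, V, hsub, hV, fun z hz => le_antisymm ?_ ?_⟩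
  · refine hyperbolicDensity_le hne fun ρ hρ => ?_
    have hρ1 := hρ.max hG hσ
    have hpos : ∀ w ∈ G, 0 < max (ρ w) (σ w) := fun w hw => lt_max_of_lt_right (hσpos w hw)
    refine (le_max_left (ρ z) (σ z)).trans ?_
    rw [← Real.log_le_iff_le_exp (hpos z (hsub hz))]
    refine hρ1.log_le_of_liouville hpos hsub hV (fun x hx => ?_) hz
    rw [hVb x hx]
    exact Real.log_le_log (hpos x (hsph hx)) (hρ1.le_hyperbolicDensity hG (hsph hx))
  · rw [← Real.le_log_iff_exp_le (hΛpos z (hsub hz))]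
    refine le_of_forall_pos_le_add fun ε hε => ?_
    obtain ⟨ρ, hρ, hpos, happ⟩ := exists_uniform_approx hG hσ hσpos (isCompact_sphere c R) hsph hε
    obtain ⟨W, hW, hWb, -⟩ := hD (fun w => Real.log (ρ w))
      ((hρ.continuousOn.mono hsph).log fun w hw => (hpos w (hsph hw)).ne')
      (fun w hw => by
        rw [Real.log_le_iff_le_exp (hpos w (hsph hw))]
        exact hM ρ hρ w (sphere_subset_closedBall hw))
    have h1 : V z ≤ W z + ε := by
      refine hW.le_add hV.continuousOn (fun x hx => ?_) hε.le (fun x hx => ?_) hz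
      · rw [(hV.hasMeanLaplacianAt x hx).lowerLaplacian_eq]
      · rw [hVb x hx, hWb x hx]
        exact happ x hx
    have h2 := (hρ.glue hG hpos hR hsub hW hWb).le_hyperbolicDensity hG (hsub hz)
    rw [piecewise_eq_of_mem _ _ _ hz, ← Real.le_log_iff_exp_le (hΛpos z (hsub hz))] at h2
    linarith

end Maximal

end SKMetric

theorem mainTheorem2 (G : Set ℂ) (hG : SKMetric.IsDomain G)
    (hne : (SKMetric.skMetrics G).Nonempty) :
    -- the supremum is finite at every point of the domain
    (∀ z ∈ G, IsLUB {x : ℝ | ∃ ρ ∈ SKMetric.skMetrics G, ρ z = x}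
      (SKMetric.hyperbolicDensity G z)) ∧
    -- it is a regular conformal metric of constant curvature -1
    SKMetric.IsConformalMetric G (SKMetric.hyperbolicDensity G) ∧
    SKMetric.IsRegular G (SKMetric.hyperbolicDensity G) ∧
    (∀ z ∈ G, SKMetric.gaussCurvature (SKMetric.hyperbolicDensity G) z = -1) ∧
    -- it is an SK-metric which dominates every SK-metric, and it is the unique maximal one
    SKMetric.IsSKMetric G (SKMetric.hyperbolicDensity G) ∧
    (∀ ρ, SKMetric.IsSKMetric G ρ → ∀ z ∈ G, ρ z ≤ SKMetric.hyperbolicDensity G z) ∧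
    SKMetric.IsMaximalSKMetric G (SKMetric.hyperbolicDensity G) ∧
    (∀ μ, SKMetric.IsMaximalSKMetric G μ → EqOn μ (SKMetric.hyperbolicDensity G) G) := by
  open SKMetric in
  obtain ⟨hGo, hGc⟩ := hG
  obtain ⟨ρ₀, hρ₀⟩ := id hne
  obtain ⟨a, ha, b, hb, hab⟩ := IsSKMetric.compl_nontrivial hρ₀ hGo
  obtain ⟨σ, hσ, hσpos⟩ := exists_pos_isSKMetric hGo hGc.nonempty hab ha hb
  have hpos : ∀ z ∈ G, 0 < hyperbolicDensity G z := fun z hz =>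
    hyperbolicDensity_pos hGo hσ hσpos hz
  have hdom : ∀ ρ, IsSKMetric G ρ → ∀ z ∈ G, ρ z ≤ hyperbolicDensity G z :=
    fun ρ hρ z hz => hρ.le_hyperbolicDensity hGo hz
  have hlocal : ∀ z ∈ G, ∃ V : ℂ → ℝ, ContDiffAt ℝ 2 V z ∧
      HasMeanLaplacianAt V (Real.exp (2 * V z)) z ∧
      ∀ᶠ w in 𝓝 z, hyperbolicDensity G w = Real.exp (V w) := by
    intro z hz
    obtain ⟨R, hR, V, -, hV, hVe⟩ := exists_liouville_eq_hyperbolicDensity hGo hσ hσpos hz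
    have hzb := Metric.mem_ball_self (x := z) hR
    exact ⟨V, hV.contDiffAt z hzb, hV.hasMeanLaplacianAt z hzb,
      eventually_of_mem (Metric.closedBall_mem_nhds z hR) hVe⟩
  have hconf : IsConformalPseudoMetric G (hyperbolicDensity G) := by
    refine ⟨fun z hz => (continuousAt_hyperbolicDensity hGo hσ hσpos hz).continuousWithinAt,
      fun z hz => (hpos z hz).le, ?_⟩
    obtain ⟨z, hz⟩ := hGc.nonempty
    exact ⟨z, hz, (hpos z hz).ne'⟩
  have hlogV : ∀ {V : ℂ → ℝ} {z : ℂ}, (∀ᶠ w in 𝓝 z, hyperbolicDensity G w = Real.exp (V w)) →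
      ∀ᶠ w in 𝓝 z, V w = Real.log (hyperbolicDensity G w) := fun h => by
    filter_upwards [h] with w hw
    rw [hw, Real.log_exp]
  have hsq : ∀ x : ℝ, Real.exp x ^ 2 = Real.exp (2 * x) := fun x => by
    rw [two_mul, Real.exp_add, sq]
  have hSK : IsSKMetric G (hyperbolicDensity G) := by
    refine ⟨hconf, fun z hz h => ?_⟩
    obtain ⟨V, -, hL, hV⟩ := hlocal z hz
    rw [lowerCurvature_le_neg_one_iff h, (hL.congr (hlogV hV)).lowerLaplacian_eq,
      hV.self_of_nhds, hsq]
  refine ⟨fun z hz => isLUB_hyperbolicDensity hGo hne hz, ⟨hconf, hpos⟩, ?_, ?_, hSK, hdom,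
    ⟨hSK, fun ν hν hle z hz => le_antisymm (hle z hz) (hdom ν hν z hz)⟩,
    fun μ hμ => hμ.2 _ hSK (hdom μ hμ.1)⟩
  · rintro z ⟨hz, -⟩
    obtain ⟨V, hV2, -, hV⟩ := hlocal z hz
    exact (hV2.exp.congr_of_eventuallyEq hV).contDiffWithinAt
  · intro z hz
    obtain ⟨V, hV2, hL, hV⟩ := hlocal z hz
    have h1 := (InnerProductSpace.laplacian_congr_nhds (hlogV hV)).eq_of_nhds
    have h2 := (hasMeanLaplacianAt_of_contDiffAt hV2).unique hL
    rw [gaussCurvature, ← h1, h2, hV.self_of_nhds, hsq, neg_div, div_self (Real.exp_pos _).ne']
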